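/- Consider the (rescaled) Hamiltonian generic $abcd$ Boussinesq system on $\mathbb R_t\times\mathbb R_x$, $$ \begin{cases} (1-\partial_x^2)\partial_t\eta+\partial_x\left(a\,\partial_x^2u+u+u\eta\right)=0,\\ (1-\partial_x^2)\partial_tu+\partial_x\left(c\,\partial_x^2\eta+\eta+\tfrac12u^2\right)=0, \end{cases} \tag{B} $$ for real-valued $u,\eta$, where $a,c<0$, $b>0$ and, for some $\theta\in[0,1]$, $a+1=\frac1{2b}\left(\theta^2-\frac13\right)$ and $c+1=\frac1{2b}(1-\theta^2)$. Assume moreover that the parameters are dispersion-like: $3(a+c)+2<8ac$. Solutions are global solutions $(u,\eta)\in C(\mathbb R,H^1(\mathbb R)\times H^1(\mathbb R))$ of (B), with $x$-derivatives in the sense of distributions. A solitary wave of speed $\omega\in\mathbb R$ with profile $(U,N)\in H^1\times H^1$ is a solution of the form $u(t,x)=U(x-\omega t)$, $\eta(t,x)=N(x-\omega t)$. A standing breather is a global solution in $C(\mathbb R,H^1\times H^1)$ which is periodic in time. For $C_0>0$ and $|t|\ge2$ let $$I(t)=\left(-\frac{C_0|t|}{\log^2|t|},\ \frac{C_0|t|}{\log^2|t|}\right).$$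 Then there is $\varepsilon>0$, depending only on the parameters $(a,b,c)$, such that the following hold. 1. There is no solitary wave of speed $\omega=0$ with nonzero profile $(U,N)$ satisfying $\|(U,N)\|_{H^1\times H^1}<\varepsilon$. 2. Every solitary wave of speed $\omega\neq0$, no matter how small $|\omega|$ is, whose profile satisfies $\|(U,N)\|_{H^1\times H^1}<\varepsilon$, leaves $I(t)$ in finite time, for every $C_0>0$. That is, for every $R\in\mathbb R$ there is $T\ge2$ such that $[\omega t-R,\omega t+R]\cap I(t)=\emptyset$ whenever $|t|\ge T$; and for every $\delta>0$ there is $T\ge2$ such that $\|(u,\eta)(t)\|_{(H^1\times H^1)(I(t))}<\delta$ whenever $|t|\ge T$. 3. There is no standing breather $(u,\eta)$, other than $(0,0)$, with $\|(u,\eta)(0)\|_{H^1\times H^1}<\varepsilon$. -/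

import Mathlib

open MeasureTheory Filter Topology Set

noncomputable section

namespace ABCD

/-- A real test function on the line: smooth with compact support. -/
def IsTest (ψ : ℝ → ℝ) : Prop :=
  ContDiff ℝ (⊤ : ℕ∞) ψ ∧ HasCompactSupport ψ

/-- The real space `L²(ℝ)`. -/
abbrev L2 : Type := Lp ℝ 2 (volume : Measure ℝ)

/-- `g` is the weak derivative of `f` on the line. -/
def IsWeakDeriv (f g : ℝ → ℝ) : Prop :=
  ∀ ψ : ℝ → ℝ, IsTest ψ → ∫ x, f x * deriv ψ x = -∫ x, g x * ψ x

theorem integrable_mul_test (f : L2) {ψ : ℝ → ℝ} (hc : Continuous ψ)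
    (hs : HasCompactSupport ψ) : Integrable (fun x => f x * ψ x) :=
  (Lp.memLp f).integrable_mul (q := 2) (hc.memLp_of_hasCompactSupport hs)

theorem IsTest.integrable_mul_deriv {ψ : ℝ → ℝ} (h : IsTest ψ) (f : L2) :
    Integrable (fun x => f x * deriv ψ x) :=
  integrable_mul_test f (h.1.continuous_deriv (by simp)) h.2.deriv

theorem IsTest.integrable_mul {ψ : ℝ → ℝ} (h : IsTest ψ) (f : L2) :
    Integrable (fun x => f x * ψ x) :=
  integrable_mul_test f h.1.continuous h.2

/-- The Sobolev space `H¹(ℝ)` of real functions, as the space of pairs `(f, g)` in `L² × L²` such that `g` is the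
weak derivative of `f`. It carries the norm `(‖f‖² + ‖g‖²)^(1/2)`. -/
def sobolevSubmodule : Submodule ℝ (WithLp 2 (L2 × L2)) where
  carrier := {p | IsWeakDeriv p.fst p.snd}
  zero_mem' := by
    intro ψ _
    have h0 : ((0 : L2) : ℝ → ℝ) =ᵐ[volume] 0 := Lp.coeFn_zero ℝ 2 volume
    have h1 : ∫ x, (0 : L2) x * deriv ψ x = 0 := by
      refine integral_eq_zero_of_ae ?_
      filter_upwards [h0] with x hx
      rw [hx, Pi.zero_apply, zero_mul]
    have h2 : ∫ x, (0 : L2) x * ψ x = 0 := by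
      refine integral_eq_zero_of_ae ?_
      filter_upwards [h0] with x hx
      rw [hx, Pi.zero_apply, zero_mul]
    change ∫ x, (0 : L2) x * deriv ψ x = -∫ x, (0 : L2) x * ψ x
    rw [h1, h2, neg_zero]
  add_mem' := by
    intro p q hp hq ψ hψ
    have h1 : ∫ x, (p.fst + q.fst : L2) x * deriv ψ x
        = (∫ x, p.fst x * deriv ψ x) + ∫ x, q.fst x * deriv ψ x := by
      rw [← integral_add (hψ.integrable_mul_deriv _) (hψ.integrable_mul_deriv _)]
      refine integral_congr_ae ?_
      filter_upwards [Lp.coeFn_add p.fst q.fst] with x hx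
      rw [hx, Pi.add_apply, add_mul]
    have h2 : ∫ x, (p.snd + q.snd : L2) x * ψ x
        = (∫ x, p.snd x * ψ x) + ∫ x, q.snd x * ψ x := by
      rw [← integral_add (hψ.integrable_mul _) (hψ.integrable_mul _)]
      refine integral_congr_ae ?_
      filter_upwards [Lp.coeFn_add p.snd q.snd] with x hx
      rw [hx, Pi.add_apply, add_mul]
    change ∫ x, (p.fst + q.fst : L2) x * deriv ψ x = -∫ x, (p.snd + q.snd : L2) x * ψ x
    rw [h1, h2, hp ψ hψ, hq ψ hψ, neg_add]
  smul_mem' := by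
    intro c p hp ψ hψ
    have h1 : ∫ x, (c • p.fst : L2) x * deriv ψ x = c * ∫ x, p.fst x * deriv ψ x := by
      rw [← integral_const_mul]
      refine integral_congr_ae ?_
      filter_upwards [Lp.coeFn_smul c p.fst] with x hx
      rw [hx, Pi.smul_apply, smul_eq_mul, mul_assoc]
    have h2 : ∫ x, (c • p.snd : L2) x * ψ x = c * ∫ x, p.snd x * ψ x := by
      rw [← integral_const_mul]
      refine integral_congr_ae ?_
      filter_upwards [Lp.coeFn_smul c p.snd] with x hx
      rw [hx, Pi.smul_apply, smul_eq_mul, mul_assoc]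
    change ∫ x, (c • p.fst : L2) x * deriv ψ x = -∫ x, (c • p.snd : L2) x * ψ x
    rw [h1, h2, hp ψ hψ, mul_neg]

/-- `H¹(ℝ)` as a normed space. -/
abbrev H1 : Type := sobolevSubmodule

/-- The function underlying an element of `H¹(ℝ)` (defined up to null sets). -/
def H1.fn (f : H1) : ℝ → ℝ := f.1.fst

/-- The weak derivative of an element of `H¹(ℝ)` (defined up to null sets). -/
def H1.dx (f : H1) : ℝ → ℝ := f.1.snd

/-- The norm of `(f, g)` in the energy space `H¹ × H¹`. -/
def energyNorm (f g : H1) : ℝ := Real.sqrt (‖f‖ ^ 2 + ‖g‖ ^ 2)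

/-- The norm of `(f, g)` in `(H¹ × H¹)(S)`, for a measurable `S ⊆ ℝ`. -/
def localEnergyNorm (S : Set ℝ) (f g : H1) : ℝ :=
  Real.sqrt (∫ x in S, (f.fn x ^ 2 + f.dx x ^ 2 + g.fn x ^ 2 + g.dx x ^ 2))

/-- The standing conditions on the (rescaled) parameters of the Hamiltonian generic system. -/
def IsParam (a b c : ℝ) : Prop :=
  0 < b ∧ a < 0 ∧ c < 0 ∧ ∃ θ ∈ Icc (0 : ℝ) 1,
    a + 1 = 1 / (2 * b) * (θ ^ 2 - 1 / 3) ∧ c + 1 = 1 / (2 * b) * (1 - θ ^ 2)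

/-- Dispersion-like parameters. -/
def IsDispersionLike (a b c : ℝ) : Prop :=
  IsParam a b c ∧ 3 * (a + c) + 2 < 8 * a * c

/-- `(u, η) ∈ C(ℝ, H¹ × H¹)` is a global solution of
`(1 - ∂ₓ²) ∂ₜ η + ∂ₓ (a ∂ₓ² u + u + u η) = 0`,
`(1 - ∂ₓ²) ∂ₜ u + ∂ₓ (c ∂ₓ² η + η + u² / 2) = 0`.
The derivatives in `x` are in the sense of distributions: they are moved to a test function `ψ`,
and the pairing with `(1 - ∂ₓ²) ψ` is differentiable in `t`. -/
structure IsSolution (a c : ℝ) (u η : ℝ → H1) : Prop where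
  continuous_u : Continuous u
  continuous_η : Continuous η
  eq_η : ∀ ψ : ℝ → ℝ, IsTest ψ → ∀ t : ℝ,
    HasDerivAt (fun s => ∫ x, (η s).fn x * (ψ x - iteratedDeriv 2 ψ x))
      (∫ x, (a * (u t).fn x * iteratedDeriv 3 ψ x
        + ((u t).fn x + (u t).fn x * (η t).fn x) * deriv ψ x)) t
  eq_u : ∀ ψ : ℝ → ℝ, IsTest ψ → ∀ t : ℝ,
    HasDerivAt (fun s => ∫ x, (u s).fn x * (ψ x - iteratedDeriv 2 ψ x))
      (∫ x, (c * (η t).fn x * iteratedDeriv 3 ψ x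
        + ((η t).fn x + 1 / 2 * (u t).fn x ^ 2) * deriv ψ x)) t

/-- `(u, η)` is a solitary wave with speed `ω` and profile `(U, N) ∈ H¹ × H¹`: a solution with
`u(t, x) = U(x - ω t)` and `η(t, x) = N(x - ω t)`. -/
structure IsSolitaryWave (a c ω : ℝ) (U N : H1) (u η : ℝ → H1) : Prop where
  solution : IsSolution a c u η
  u_eq : ∀ t : ℝ, (u t).fn =ᵐ[volume] fun x => U.fn (x - ω * t)
  η_eq : ∀ t : ℝ, (η t).fn =ᵐ[volume] fun x => N.fn (x - ω * t)

/-- `(u, η)` is a standing breather: a global solution in the energy space, periodic in time. -/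
def IsBreather (a c : ℝ) (u η : ℝ → H1) : Prop :=
  IsSolution a c u η ∧ ∃ P : ℝ, 0 < P ∧ ∀ t : ℝ, u (t + P) = u t ∧ η (t + P) = η t

/-- The interval `I(t)` with constant `C₀`; it is only used for `|t| ≥ 2`. -/
def I (C₀ t : ℝ) : Set ℝ :=
  Ioo (-(C₀ * |t| / Real.log |t| ^ 2)) (C₀ * |t| / Real.log |t| ^ 2)

end ABCD

end

noncomputable section

namespace ABCD

/-! ### Basic facts on `L²` and `H¹` -/

/-! A wave of zero speed is stationary, so statements 1 and 3 are one assertion: a small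
time-periodic solution vanishes (`IsSolution.eq_zero_of_periodic`). Conservation of the Hamiltonian,
which is coercive near zero, keeps small data small for all time (`exists_small`). Two virial
functionals are then integrated over a period: the weighted momentum ∫ φ (u η + uₓ ηₓ) and ∫ u ηₓ.
Both return to their initial values, so the time integrals of their derivatives vanish. Since the
period is finite, φ' can be sent to 1 by dominated convergence, and no localized estimate is needed.

Adding (p - 1)/2 times the second identity to the first gives, at quadratic order, a form in u with
parameter p plus a form in η with parameter 2 - p. In the variable f = (1 - ∂ₓ²)⁻¹ u such a form is
diagonal in the L² norms of f, f', f'', f''' (`virialForm_ge`). The dispersion-like inequality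
provides a p for which all coefficients of both forms are positive (`exists_coercive`). Smallness
absorbs the cubic terms (`virial_ge`), so a continuous quantity bounded below by a multiple of the
squared energy norm has zero integral over a period.

The difficulty is regularity: for a solution in H¹ the equation gives time derivatives only in L²,
too rough to differentiate functionals containing uₓ and ηₓ. Averages over [s, s + h] are C¹ in time
with values in H¹, and the equation then places them in H² (`Evol.exists_strongEq`). The identities
are proved for averages, where the averaged nonlinearity is an independent L² variable. Their terms
are continuous in H¹ × H¹ × L² × L², so h → 0 is harmless (`IsSolution.integral_identity`).

Statement 2 is kinematic: |ω t| eventually exceeds the half-width of I(t) by any fixed amount, and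
the profile has small H¹ mass far from its centre. -/

theorem L2_inner (f g : L2) : inner ℝ f g = ∫ x, f x * g x := by
  rw [L2.inner_def]
  refine integral_congr_ae (Eventually.of_forall fun x => ?_)
  simp [mul_comm]

theorem L2_integrable_mul (f g : L2) : Integrable (fun x => f x * g x) :=
  (Lp.memLp f).integrable_mul (q := 2) (Lp.memLp g)

/-- The inclusion `H¹ → L²`. -/
def val : H1 →L[ℝ] L2 := (WithLp.fstL 2 ℝ L2 L2).comp sobolevSubmodule.subtypeL

/-- The weak derivative `H¹ → L²`. -/
def dv : H1 →L[ℝ] L2 := (WithLp.sndL 2 ℝ L2 L2).comp sobolevSubmodule.subtypeL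

theorem coe_val (f : H1) : (val f : ℝ → ℝ) = f.fn := rfl

theorem H1_inner (f g : H1) : inner ℝ f g = inner ℝ (val f) (val g) + inner ℝ (dv f) (dv g) :=
  WithLp.prod_inner_apply _ _

theorem H1_norm_sq (f : H1) : ‖f‖ ^ 2 = ‖val f‖ ^ 2 + ‖dv f‖ ^ 2 := by
  rw [← real_inner_self_eq_norm_sq, ← real_inner_self_eq_norm_sq, ← real_inner_self_eq_norm_sq,
    H1_inner]

theorem norm_val_le (f : H1) : ‖val f‖ ≤ ‖f‖ := by
  refine abs_le_of_sq_le_sq' ?_ (norm_nonneg _) |>.2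
  rw [H1_norm_sq]; nlinarith [sq_nonneg ‖dv f‖]

theorem norm_dv_le (f : H1) : ‖dv f‖ ≤ ‖f‖ := by
  refine abs_le_of_sq_le_sq' ?_ (norm_nonneg _) |>.2
  rw [H1_norm_sq]; nlinarith [sq_nonneg ‖val f‖]

namespace IsTest

variable {ψ χ : ℝ → ℝ}

theorem deriv (h : IsTest ψ) : IsTest (deriv ψ) :=
  ⟨(contDiff_infty_iff_deriv.1 h.1).2, h.2.deriv⟩

theorem continuous (h : IsTest ψ) : Continuous ψ := h.1.continuous

theorem hasDerivAt (h : IsTest ψ) (x : ℝ) : HasDerivAt ψ (_root_.deriv ψ x) x :=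
  ((contDiff_infty_iff_deriv.1 h.1).1 x).hasDerivAt

theorem add (h : IsTest ψ) (k : IsTest χ) : IsTest (ψ + χ) := ⟨h.1.add k.1, h.2.add k.2⟩

theorem smul (c : ℝ) (h : IsTest ψ) : IsTest (c • ψ) := ⟨contDiff_const.smul h.1, h.2.smul_left⟩

theorem mul (h : IsTest ψ) (k : IsTest χ) : IsTest (ψ * χ) := ⟨h.1.mul k.1, h.2.mul_right⟩

theorem memLp (h : IsTest ψ) : MemLp ψ 2 := h.continuous.memLp_of_hasCompactSupport h.2

/-- A test function as an element of `L²`. -/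
def toL2 (h : IsTest ψ) : L2 := h.memLp.toLp ψ

theorem coe_toL2 (h : IsTest ψ) : (h.toL2 : ℝ → ℝ) =ᵐ[volume] ψ := h.memLp.coeFn_toLp

theorem inner_toL2 (h : IsTest ψ) (f : L2) : inner ℝ f h.toL2 = ∫ x, f x * ψ x := by
  rw [L2_inner]
  refine integral_congr_ae ?_
  filter_upwards [h.coe_toL2] with x hx
  rw [hx]

theorem integral_mul_deriv (h : IsTest ψ) (k : IsTest χ) :
    ∫ x, ψ x * _root_.deriv χ x = -∫ x, _root_.deriv ψ x * χ x :=
  integral_mul_deriv_eq_deriv_mul_of_integrable (fun x _ => h.hasDerivAt x)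
    (fun x _ => k.hasDerivAt x)
    ((h.mul k.deriv).continuous.integrable_of_hasCompactSupport (h.mul k.deriv).2)
    ((h.deriv.mul k).continuous.integrable_of_hasCompactSupport (h.deriv.mul k).2)
    ((h.mul k).continuous.integrable_of_hasCompactSupport (h.mul k).2)

theorem isWeakDeriv (h : IsTest ψ) : IsWeakDeriv h.toL2 h.deriv.toL2 := by
  intro χ k
  rw [← k.inner_toL2, ← k.deriv.inner_toL2, real_inner_comm, real_inner_comm k.toL2,
    h.inner_toL2, h.deriv.inner_toL2]
  have e1 : ∫ x, k.deriv.toL2 x * ψ x = ∫ x, ψ x * _root_.deriv χ x :=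
    integral_congr_ae (by filter_upwards [k.deriv.coe_toL2] with x hx; rw [hx, mul_comm])
  have e2 : ∫ x, k.toL2 x * _root_.deriv ψ x = ∫ x, _root_.deriv ψ x * χ x :=
    integral_congr_ae (by filter_upwards [k.coe_toL2] with x hx; rw [hx, mul_comm])
  rw [e1, e2, h.integral_mul_deriv k]

/-- A test function as an element of `H¹`. -/
def toH1 (h : IsTest ψ) : H1 := ⟨WithLp.toLp 2 (h.toL2, h.deriv.toL2), h.isWeakDeriv⟩

theorem val_toH1 (h : IsTest ψ) : val h.toH1 = h.toL2 := rfl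

theorem dv_toH1 (h : IsTest ψ) : dv h.toH1 = h.deriv.toL2 := rfl

end IsTest

theorem isWeakDeriv_iff_inner (f g : L2) : IsWeakDeriv f g ↔
    ∀ (ψ : ℝ → ℝ) (h : IsTest ψ), inner ℝ f h.deriv.toL2 = -inner ℝ g h.toL2 := by
  refine forall₂_congr fun ψ h => ?_
  rw [h.inner_toL2, h.deriv.inner_toL2]

theorem isClosed_sobolevSubmodule : IsClosed (sobolevSubmodule : Set (WithLp 2 (L2 × L2))) := by
  have : (sobolevSubmodule : Set (WithLp 2 (L2 × L2))) =
      ⋂ (ψ : ℝ → ℝ) (h : IsTest ψ), {p | inner ℝ (WithLp.fstL 2 ℝ L2 L2 p) h.deriv.toL2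
        = -inner ℝ (WithLp.sndL 2 ℝ L2 L2 p) h.toL2} := by
    ext p
    simp only [mem_iInter]
    exact isWeakDeriv_iff_inner _ _
  rw [this]
  refine isClosed_iInter fun ψ => isClosed_iInter fun h => isClosed_eq ?_ ?_ <;> fun_prop

instance : CompleteSpace H1 := isClosed_sobolevSubmodule.completeSpace_coe

theorem inner_dv_test (f : H1) {ψ : ℝ → ℝ} (h : IsTest ψ) :
    inner ℝ (dv f) h.toL2 = -inner ℝ (val f) h.deriv.toL2 := by
  have := (isWeakDeriv_iff_inner (val f) (dv f)).1 f.2 ψ h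
  rw [this, neg_neg]

/-- An element of `L²` that is orthogonal to all test functions vanishes. -/
theorem L2_eq_zero_of_test (z : L2) (hz : ∀ (ψ : ℝ → ℝ) (h : IsTest ψ), inner ℝ z h.toL2 = 0) :
    z = 0 := by
  rw [Lp.eq_zero_iff_ae_eq_zero]
  refine ae_eq_zero_of_integral_contDiff_smul_eq_zero
    ((Lp.memLp z).locallyIntegrable (by norm_num)) fun g hg hs => ?_
  have ht : IsTest g := ⟨hg, hs⟩
  have := hz g ht
  rw [ht.inner_toL2] at this
  simpa [mul_comm] using this

theorem val_injective : Function.Injective val := by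
  intro f g h
  have h2 : dv f = dv g := by
    rw [← sub_eq_zero]
    refine L2_eq_zero_of_test _ fun ψ k => ?_
    rw [inner_sub_left, inner_dv_test, inner_dv_test, h, sub_self]
  refine Subtype.ext ?_
  apply (WithLp.equiv 2 (L2 × L2)).injective
  exact Prod.ext h h2

/-- A bounded solution of `Z'' = Z` on the line vanishes. -/
theorem eq_zero_of_deriv_deriv_eq_self {Z Z' : ℝ → ℝ} (h1 : ∀ x, HasDerivAt Z (Z' x) x)
    (h2 : ∀ x, HasDerivAt Z' (Z x) x) {C : ℝ} (b1 : ∀ x, |Z x| ≤ C) (b2 : ∀ x, |Z' x| ≤ C)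
    (x : ℝ) : Z x = 0 := by
  have key1 : ∀ x, Real.exp (-x) * (Z x + Z' x) = Z 0 + Z' 0 := by
    -- Z'' = Z makes e⁻ˣ(Z + Z') and eˣ(Z - Z') constant; boundedness forces both constants to
    -- vanish, at +∞ and -∞ respectively.
    intro x
    have hd : ∀ y, HasDerivAt (fun y => Real.exp (-y) * (Z y + Z' y)) 0 y := by
      intro y
      have := ((hasDerivAt_neg y).exp).mul ((h1 y).add (h2 y))
      exact this.congr_deriv (by simp; ring)
    have := is_const_of_deriv_eq_zero (fun y => (hd y).differentiableAt) (fun y => (hd y).deriv) x 0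
    simpa using this
  have key2 : ∀ x, Real.exp x * (Z x - Z' x) = Z 0 - Z' 0 := by
    intro x
    have hd : ∀ y, HasDerivAt (fun y => Real.exp y * (Z y - Z' y)) 0 y := by
      intro y
      have := (Real.hasDerivAt_exp y).mul ((h1 y).sub (h2 y))
      exact this.congr_deriv (by simp; ring)
    have := is_const_of_deriv_eq_zero (fun y => (hd y).differentiableAt) (fun y => (hd y).deriv) x 0
    simpa using this
  have lim1 : Tendsto (fun x : ℝ => Real.exp (-x) * (Z x + Z' x)) atTop (𝓝 0) := by
    refine squeeze_zero_norm (a := fun x => Real.exp (-x) * (2 * C)) (fun x => ?_) ?_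
    · rw [norm_mul, Real.norm_eq_abs, Real.norm_eq_abs, abs_of_pos (Real.exp_pos _)]
      refine mul_le_mul_of_nonneg_left ?_ (Real.exp_pos _).le
      linarith [abs_add_le (Z x) (Z' x), b1 x, b2 x]
    · simpa using (Real.tendsto_exp_neg_atTop_nhds_zero).mul_const (2 * C)
  have lim2 : Tendsto (fun x : ℝ => Real.exp x * (Z x - Z' x)) atBot (𝓝 0) := by
    refine squeeze_zero_norm (a := fun x => Real.exp x * (2 * C)) (fun x => ?_) ?_
    · rw [norm_mul, Real.norm_eq_abs, Real.norm_eq_abs, abs_of_pos (Real.exp_pos _)]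
      refine mul_le_mul_of_nonneg_left ?_ (Real.exp_pos _).le
      linarith [abs_sub (Z x) (Z' x), b1 x, b2 x]
    · simpa using (Real.tendsto_exp_atBot).mul_const (2 * C)
  simp only [key1] at lim1
  simp only [key2] at lim2
  have c1 := tendsto_nhds_unique lim1 tendsto_const_nhds
  have c2 := tendsto_nhds_unique lim2 tendsto_const_nhds
  have e1 := key1 x
  have e2 := key2 x
  rw [← c1] at e1
  rw [← c2] at e2
  have := (mul_eq_zero.1 e1).resolve_left (Real.exp_pos _).ne'
  have := (mul_eq_zero.1 e2).resolve_left (Real.exp_pos _).ne'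
  linarith

/-- The range of `1 - ∂ₓ²` on test functions is dense in `L²`. -/
theorem L2_eq_zero_of_test_sub (z : L2)
    (hz : ∀ (ψ : ℝ → ℝ) (h : IsTest ψ), inner ℝ z h.toL2 = inner ℝ z h.deriv.deriv.toL2) :
    z = 0 := by
  refine L2_eq_zero_of_test z fun ρ hρ => ?_
  have hfl : ∀ {φ : ℝ → ℝ}, IsTest φ → ∀ x : ℝ, IsTest (fun y => φ (x - y)) := fun h x =>
    ⟨h.1.comp (contDiff_const.sub contDiff_id),
      h.2.comp_homeomorph (Homeomorph.subLeft x)⟩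
  -- The reflection makes the value of z ∗ σ at 0 equal to ∫ z ρ. The hypothesis, tested on
  -- translates, says that the smooth function Z = z ∗ σ satisfies Z'' = Z, and Cauchy–Schwarz
  -- bounds Z and Z'.
  set σ : ℝ → ℝ := fun y => ρ (0 - y) with hσdef
  have hσ : IsTest σ := hfl hρ 0
  let L := ContinuousLinearMap.mul ℝ ℝ
  have hloc : LocallyIntegrable (z : ℝ → ℝ) := (Lp.memLp z).locallyIntegrable (by norm_num)
  have hconv : ∀ φ : ℝ → ℝ, ∀ (h : IsTest φ) (x : ℝ),
      convolution (z : ℝ → ℝ) φ L volume x = inner ℝ z (hfl h x).toL2 := by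
    intro φ h x
    rw [IsTest.inner_toL2]; rfl
  have hderiv : ∀ φ : ℝ → ℝ, IsTest φ → ∀ x, HasDerivAt (convolution (z : ℝ → ℝ) φ L volume)
      (convolution (z : ℝ → ℝ) (deriv φ) L volume x) x := fun φ h x =>
    HasCompactSupport.hasDerivAt_convolution_right L hloc h.2 (h.1.of_le (by exact_mod_cast le_top)) x
  have hbd : ∀ φ : ℝ → ℝ, ∀ (h : IsTest φ), ∀ x, |convolution (z : ℝ → ℝ) φ L volume x|
      ≤ ‖z‖ * ‖h.toL2‖ := by
    intro φ h x
    rw [hconv φ h x]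
    refine (abs_real_inner_le_norm _ _).trans (mul_le_mul_of_nonneg_left (le_of_eq ?_) (norm_nonneg _))
    simp only [IsTest.toL2, Lp.norm_toLp]
    congr 1
    exact eLpNorm_comp_measurePreserving h.continuous.aestronglyMeasurable
      (Measure.measurePreserving_sub_left volume x)
  have hself : ∀ x, convolution (z : ℝ → ℝ) (deriv (deriv σ)) L volume x
      = convolution (z : ℝ → ℝ) σ L volume x := by
    intro x
    rw [hconv _ hσ x, hz, hconv _ hσ.deriv.deriv x, IsTest.inner_toL2, IsTest.inner_toL2]
    have d1 : ∀ φ : ℝ → ℝ, deriv (fun y => φ (x - y)) = fun y => -deriv φ (x - y) := by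
      intro φ; funext y; exact deriv_comp_const_sub _ _ _
    have d2 : deriv (deriv fun y => σ (x - y)) = fun y => deriv (deriv σ) (x - y) := by
      rw [d1]
      funext y
      rw [deriv.fun_neg, d1, neg_neg]
    rw [d2]
  have hzero := eq_zero_of_deriv_deriv_eq_self (hderiv σ hσ)
    (fun x => (hself x) ▸ hderiv _ hσ.deriv x)
    (C := max (‖z‖ * ‖hσ.toL2‖) (‖z‖ * ‖hσ.deriv.toL2‖))
    (fun x => (hbd σ hσ x).trans (le_max_left _ _))
    (fun x => (hbd _ hσ.deriv x).trans (le_max_right _ _)) 0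
  rw [hconv σ hσ 0, IsTest.inner_toL2] at hzero
  rw [IsTest.inner_toL2, ← hzero]
  simp [σ]

/-- The test functions as a subspace of `H¹`. -/
def testSubmodule : Submodule ℝ H1 where
  carrier := {f | ∃ (ψ : ℝ → ℝ) (h : IsTest ψ), h.toH1 = f}
  zero_mem' := by
    have h : IsTest 0 := ⟨contDiff_const, HasCompactSupport.zero⟩
    refine ⟨0, h, val_injective ?_⟩
    rw [map_zero, h.val_toH1]
    exact MemLp.toLp_zero _
  add_mem' := by
    rintro _ _ ⟨ψ, h, rfl⟩ ⟨χ, k, rfl⟩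
    exact ⟨ψ + χ, h.add k, val_injective (by
      rw [map_add]; exact MemLp.toLp_add h.memLp k.memLp)⟩
  smul_mem' := by
    rintro c _ ⟨ψ, h, rfl⟩
    exact ⟨c • ψ, h.smul c, val_injective (by rw [map_smul]; exact MemLp.toLp_const_smul c h.memLp)⟩

/-- An f orthogonal in H¹ to all test functions satisfies f - f'' = 0 weakly, hence vanishes by
`L2_eq_zero_of_test_sub`. -/
theorem testSubmodule_topologicalClosure : testSubmodule.topologicalClosure = ⊤ := by
  rw [Submodule.topologicalClosure_eq_top_iff, Submodule.eq_bot_iff]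
  intro f hf
  refine val_injective ?_
  rw [map_zero]
  refine L2_eq_zero_of_test_sub _ fun ψ h => ?_
  have := (Submodule.mem_orthogonal' _ _).1 hf h.toH1 ⟨ψ, h, rfl⟩
  rw [H1_inner, IsTest.val_toH1, IsTest.dv_toH1, inner_dv_test] at this
  linarith

/-- A closed property that holds for test functions holds on `H¹`. -/
theorem H1_induction {p : H1 → Prop} (hc : IsClosed {f | p f})
    (ht : ∀ (ψ : ℝ → ℝ) (h : IsTest ψ), p h.toH1) (f : H1) : p f := by
  have hd : Dense (testSubmodule : Set H1) :=
    (Submodule.dense_iff_topologicalClosure_eq_top).2 testSubmodule_topologicalClosure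
  refine hc.closure_subset_iff.2 ?_ (hd f)
  rintro _ ⟨ψ, h, rfl⟩
  exact ht ψ h

/-! ### Multiplication operators -/

theorem memLp_bdd_mul {φ : ℝ → ℝ} {C : ℝ} (hm : AEStronglyMeasurable φ volume)
    (hb : ∀ᵐ x, |φ x| ≤ C) (g : L2) : MemLp (fun x => φ x * g x) 2 :=
  (Lp.memLp g).of_le_mul (c := C) (hm.mul (Lp.memLp g).1) (by
    filter_upwards [hb] with x hx
    rw [norm_mul]
    exact mul_le_mul_of_nonneg_right hx (norm_nonneg _))

/-- Multiplication by a bounded function, as an operator on `L²`. -/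
def mulBdd (φ : ℝ → ℝ) (C : ℝ) (hm : AEStronglyMeasurable φ volume) (hb : ∀ᵐ x, |φ x| ≤ C) :
    L2 →L[ℝ] L2 :=
  LinearMap.mkContinuous
    { toFun := fun g => (memLp_bdd_mul hm hb g).toLp _
      map_add' := by
        intro g k
        refine Lp.ext ?_
        filter_upwards [(memLp_bdd_mul hm hb (g + k)).coeFn_toLp,
          (memLp_bdd_mul hm hb g).coeFn_toLp, (memLp_bdd_mul hm hb k).coeFn_toLp,
          Lp.coeFn_add g k, Lp.coeFn_add ((memLp_bdd_mul hm hb g).toLp _)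
            ((memLp_bdd_mul hm hb k).toLp _)] with x h1 h2 h3 h4 h5
        rw [h1, h5, Pi.add_apply, h2, h3, h4, Pi.add_apply, mul_add]
      map_smul' := by
        intro c g
        refine Lp.ext ?_
        filter_upwards [(memLp_bdd_mul hm hb (c • g)).coeFn_toLp,
          (memLp_bdd_mul hm hb g).coeFn_toLp, Lp.coeFn_smul c g,
          Lp.coeFn_smul c ((memLp_bdd_mul hm hb g).toLp _)] with x h1 h2 h3 h4
        rw [h1, RingHom.id_apply, h4, Pi.smul_apply, h2, h3, Pi.smul_apply, smul_eq_mul,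
          smul_eq_mul, mul_left_comm] } C (by
    intro g
    refine Lp.norm_le_mul_norm_of_ae_le_mul ?_
    filter_upwards [hb, (memLp_bdd_mul hm hb g).coeFn_toLp] with x h1 h2
    change ‖((memLp_bdd_mul hm hb g).toLp _ : L2) x‖ ≤ _
    rw [h2, norm_mul]
    exact mul_le_mul_of_nonneg_right h1 (norm_nonneg _))

theorem coe_mulBdd {φ : ℝ → ℝ} {C : ℝ} (hm : AEStronglyMeasurable φ volume)
    (hb : ∀ᵐ x, |φ x| ≤ C) (g : L2) : (mulBdd φ C hm hb g : ℝ → ℝ) =ᵐ[volume] fun x => φ x * g x :=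
  (memLp_bdd_mul hm hb g).coeFn_toLp

theorem norm_mulBdd_le {φ : ℝ → ℝ} {C : ℝ} (hm : AEStronglyMeasurable φ volume)
    (hb : ∀ᵐ x, |φ x| ≤ C) (g : L2) : ‖mulBdd φ C hm hb g‖ ≤ C * ‖g‖ := by
  refine Lp.norm_le_mul_norm_of_ae_le_mul ?_
  filter_upwards [hb, coe_mulBdd hm hb g] with x h1 h2
  rw [h2, norm_mul]
  exact mul_le_mul_of_nonneg_right h1 (norm_nonneg _)

theorem inner_mulBdd {φ : ℝ → ℝ} {C : ℝ} (hm : AEStronglyMeasurable φ volume)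
    (hb : ∀ᵐ x, |φ x| ≤ C) (g k : L2) :
    inner ℝ (mulBdd φ C hm hb g) k = ∫ x, φ x * (g x * k x) := by
  rw [L2_inner]
  refine integral_congr_ae ?_
  filter_upwards [coe_mulBdd hm hb g] with x h
  rw [h, mul_assoc]

/-! ### The Sobolev inequality -/

/-- Integrate (ψ²)' = 2ψψ' ≤ ψ² + ψ'² from -∞ to x; this gives the Sobolev embedding with constant
1. -/
theorem IsTest.sq_le {ψ : ℝ → ℝ} (h : IsTest ψ) (x : ℝ) : ψ x ^ 2 ≤ ‖h.toH1‖ ^ 2 := by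
  have hn : ∀ {χ : ℝ → ℝ} (k : IsTest χ), ‖k.toL2‖ ^ 2 = ∫ y, χ y ^ 2 := by
    intro χ k
    rw [← real_inner_self_eq_norm_sq, k.inner_toL2]
    refine integral_congr_ae ?_
    filter_upwards [k.coe_toL2] with y hy
    rw [hy, sq]
  have hi : ∀ {χ : ℝ → ℝ}, IsTest χ → Integrable (fun y => χ y ^ 2) := fun k => k.memLp.integrable_sq
  rw [H1_norm_sq, h.val_toH1, h.dv_toH1, hn, hn, ← integral_add (hi h) (hi h.deriv)]
  have hI : Integrable (fun y => 2 * ψ y * _root_.deriv ψ y) := by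
    have : Integrable (ψ * _root_.deriv ψ) :=
      (h.mul h.deriv).continuous.integrable_of_hasCompactSupport (h.mul h.deriv).2
    refine (this.const_mul 2).congr (Eventually.of_forall fun y => ?_)
    simp [mul_assoc]
  have h0 : Tendsto (fun y => ψ y ^ 2) atBot (𝓝 0) := by
    refine tendsto_const_nhds.congr' ?_
    have : ∀ᶠ y in cocompact ℝ, ψ y = 0 := by
      filter_upwards [h.2.compl_mem_cocompact] with y hy
      exact image_eq_zero_of_notMem_tsupport hy
    filter_upwards [atBot_le_cocompact this] with y hy
    rw [hy, zero_pow two_ne_zero]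
  have := integral_Iic_of_hasDerivAt_of_tendsto (a := x) (f := fun y => ψ y ^ 2)
    (f' := fun y => 2 * ψ y * _root_.deriv ψ y) (h.continuous.pow 2).continuousWithinAt
    (fun y _ => ((h.hasDerivAt y).pow 2).congr_deriv (by simp)) hI.integrableOn h0
  rw [sub_zero] at this
  rw [← this]
  have hs : Integrable (fun y => ψ y ^ 2 + _root_.deriv ψ y ^ 2) := (hi h).add (hi h.deriv)
  refine (setIntegral_mono hI.integrableOn hs.integrableOn fun y => ?_).trans
    (setIntegral_le_integral hs (Eventually.of_forall fun y => by positivity))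
  have := two_mul_le_add_sq (ψ y) (_root_.deriv ψ y)
  simpa using this

theorem ae_abs_le_norm (f : H1) : ∀ᵐ x, |f.fn x| ≤ ‖f‖ := by
  refine H1_induction (p := fun f => ∀ᵐ x, |f.fn x| ≤ ‖f‖) ?_ (fun ψ h => ?_) f
  · refine IsSeqClosed.isClosed fun s f hs hf => ?_
    have h1 : Tendsto (fun n => val (s n)) atTop (𝓝 (val f)) := (val.continuous.tendsto f).comp hf
    -- L² convergence gives a subsequence converging almost everywhere, along which the pointwise
    -- bounds pass to the limit.
    obtain ⟨ns, hns, hae⟩ := (tendstoInMeasure_of_tendsto_Lp h1).exists_seq_tendsto_ae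
    have h2 : ∀ᵐ x, ∀ n, |(s n).fn x| ≤ ‖s n‖ := ae_all_iff.2 hs
    change ∀ᵐ x, |f.fn x| ≤ ‖f‖
    filter_upwards [hae, h2] with x hx hb
    exact le_of_tendsto_of_tendsto' hx.abs (hf.norm.comp hns.tendsto_atTop) fun n => hb (ns n)
  · filter_upwards [h.coe_toL2] with x hx
    have e : (h.toH1).fn x = ψ x := hx
    rw [e]
    exact abs_le_of_sq_le_sq (h.sq_le x) (norm_nonneg _)

theorem aestronglyMeasurable_fn (f : H1) : AEStronglyMeasurable f.fn volume :=
  (Lp.memLp (val f)).aestronglyMeasurable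

/-- Multiplication by a fixed `H¹` function on `L²`. -/
def mulFn (f : H1) : L2 →L[ℝ] L2 :=
  mulBdd f.fn ‖f‖ (aestronglyMeasurable_fn f) (ae_abs_le_norm f)

theorem coe_mulFn (f : H1) (g : L2) : (mulFn f g : ℝ → ℝ) =ᵐ[volume] fun x => f.fn x * g x :=
  coe_mulBdd (aestronglyMeasurable_fn f) (ae_abs_le_norm f) g

/-- Multiplication of an `H¹` function and an `L²` function. -/
def mulH : H1 →L[ℝ] L2 →L[ℝ] L2 :=
  LinearMap.mkContinuous₂
    (LinearMap.mk₂ ℝ (fun (f : H1) (g : L2) => mulFn f g)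
      (by
        intro f k g
        refine Lp.ext ?_
        filter_upwards [coe_mulFn (f + k) g, coe_mulFn f g, coe_mulFn k g,
          Lp.coeFn_add (mulFn f g) (mulFn k g), Lp.coeFn_add (val f) (val k)] with x h1 h2 h3 h4 h5
        have e : (f + k).fn x = f.fn x + k.fn x := h5
        rw [h1, h4, Pi.add_apply, h2, h3, ← add_mul, e])
      (by
        intro c f g
        refine Lp.ext ?_
        filter_upwards [coe_mulFn (c • f) g, coe_mulFn f g, Lp.coeFn_smul c (mulFn f g),
          Lp.coeFn_smul c (val f)] with x h1 h2 h3 h4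
        have e : (c • f).fn x = c * f.fn x := h4
        rw [h1, h3, Pi.smul_apply, h2, smul_eq_mul, ← mul_assoc, e])
      (fun f g k => map_add _ g k) (fun c f g => map_smul _ c g))
    1 (fun f g => by
      rw [one_mul]
      exact norm_mulBdd_le (aestronglyMeasurable_fn f) (ae_abs_le_norm f) g)

theorem coe_mulH (f : H1) (g : L2) : (mulH f g : ℝ → ℝ) =ᵐ[volume] fun x => f.fn x * g x :=
  coe_mulFn f g

theorem norm_mulH_le (f : H1) (g : L2) : ‖mulH f g‖ ≤ ‖f‖ * ‖g‖ :=
  norm_mulBdd_le (aestronglyMeasurable_fn f) (ae_abs_le_norm f) g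

theorem mulH_comm (f g : H1) : mulH f (val g) = mulH g (val f) := by
  refine Lp.ext ?_
  filter_upwards [coe_mulH f (val g), coe_mulH g (val f)] with x h1 h2
  rw [h1, h2, mul_comm]; rfl

theorem inner_mulH (f : H1) (g k : L2) : inner ℝ (mulH f g) k = ∫ x, f.fn x * (g x * k x) :=
  inner_mulBdd (aestronglyMeasurable_fn f) (ae_abs_le_norm f) g k

theorem inner_mulH_comm (f : H1) (g k : L2) : inner ℝ (mulH f g) k = inner ℝ (mulH f k) g := by
  simp only [inner_mulH, mul_comm]

/-! ### Product rule -/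

theorem IsTest.mulH_toL2 {ψ χ : ℝ → ℝ} (h : IsTest ψ) (k : IsTest χ) :
    mulH h.toH1 k.toL2 = (h.mul k).toL2 := by
  refine Lp.ext ?_
  filter_upwards [coe_mulH h.toH1 k.toL2, h.coe_toL2, k.coe_toL2, (h.mul k).coe_toL2]
    with x h1 h2 h3 h4
  have e : (h.toH1).fn x = ψ x := h2
  rw [h1, h4, h3, e]; rfl

theorem IsTest.deriv_mul {ψ χ : ℝ → ℝ} (h : IsTest ψ) (k : IsTest χ) :
    _root_.deriv (ψ * χ) = _root_.deriv ψ * χ + ψ * _root_.deriv χ := by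
  funext x
  exact ((h.hasDerivAt x).mul (k.hasDerivAt x)).deriv

theorem IsTest.toL2_congr {ψ χ : ℝ → ℝ} (h : IsTest ψ) (k : IsTest χ) (e : ψ = χ) :
    h.toL2 = k.toL2 := by
  subst e; rfl

/-- The product of two `H¹` functions belongs to `H¹`. -/
theorem exists_mul (f g : H1) : ∃ q : H1, val q = mulH f (val g) ∧
    dv q = mulH f (dv g) + mulH g (dv f) := by
  suffices h : ∀ f g : H1, mulH f (val g) = mulH f (val g) ∧ WithLp.toLp 2
      (mulH f (val g), mulH f (dv g) + mulH g (dv f)) ∈ sobolevSubmodule from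
    ⟨⟨_, (h f g).2⟩, rfl, rfl⟩
  intro f g
  refine ⟨rfl, ?_⟩
  have hcont : Continuous fun p : H1 × H1 => (WithLp.toLp 2
      (mulH p.1 (val p.2), mulH p.1 (dv p.2) + mulH p.2 (dv p.1)) : WithLp 2 (L2 × L2)) := by
    refine (WithLp.prod_continuous_toLp 2 L2 L2).comp ?_
    fun_prop
  refine H1_induction (p := fun f => WithLp.toLp 2
      (mulH f (val g), mulH f (dv g) + mulH g (dv f)) ∈ sobolevSubmodule) ?_ (fun ψ h => ?_) f
  · exact isClosed_sobolevSubmodule.preimage (hcont.comp (by fun_prop : Continuous fun f => (f, g)))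
  refine H1_induction (p := fun g => WithLp.toLp 2
      (mulH h.toH1 (val g), mulH h.toH1 (dv g) + mulH g (dv h.toH1)) ∈ sobolevSubmodule) ?_
      (fun χ k => ?_) g
  · exact isClosed_sobolevSubmodule.preimage
      (hcont.comp (by fun_prop : Continuous fun g => (h.toH1, g)))
  · have e : mulH h.toH1 (dv k.toH1) + mulH k.toH1 (dv h.toH1) = (h.mul k).deriv.toL2 := by
      rw [k.dv_toH1, h.dv_toH1, h.mulH_toL2 k.deriv, k.mulH_toL2 h.deriv]
      rw [(h.mul k).deriv.toL2_congr ((h.mul k.deriv).add (k.mul h.deriv))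
        (by rw [h.deriv_mul k, mul_comm χ, add_comm])]
      exact (MemLp.toLp_add _ _).symm
    rw [e, k.val_toH1, h.mulH_toL2 k]
    exact (h.mul k).isWeakDeriv

/-- A bounded weight with bounded derivative. -/
structure Weight where
  /-- the weight -/
  toFun : ℝ → ℝ
  /-- its derivative -/
  der : ℝ → ℝ
  /-- a common bound -/
  C : ℝ
  hasDerivAt : ∀ x, HasDerivAt toFun (der x) x
  continuous_der : Continuous der
  abs_le : ∀ x, |toFun x| ≤ C
  abs_der_le : ∀ x, |der x| ≤ C

namespace Weight

variable (φ : Weight)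

theorem continuous : Continuous φ.toFun :=
  continuous_iff_continuousAt.2 fun x => (φ.hasDerivAt x).continuousAt

/-- Multiplication by the weight. -/
def m : L2 →L[ℝ] L2 := mulBdd φ.toFun φ.C φ.continuous.aestronglyMeasurable
  (Eventually.of_forall φ.abs_le)

/-- Multiplication by the derivative of the weight. -/
def m' : L2 →L[ℝ] L2 := mulBdd φ.der φ.C φ.continuous_der.aestronglyMeasurable
  (Eventually.of_forall φ.abs_der_le)

theorem inner_m (f g : L2) : inner ℝ (φ.m f) g = ∫ x, φ.toFun x * (f x * g x) := inner_mulBdd _ _ f g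

theorem inner_m' (f g : L2) : inner ℝ (φ.m' f) g = ∫ x, φ.der x * (f x * g x) := inner_mulBdd _ _ f g

theorem inner_m_comm (f g : L2) : inner ℝ (φ.m f) g = inner ℝ (φ.m g) f := by
  simp only [inner_m, mul_comm]

/-- For test functions this is ∫ (φ f g)' = 0. Since φ and φ' are bounded, both sides are continuous
in f and g for the H¹ norm, so density suffices. -/
theorem product_rule (f g : H1) : inner ℝ (φ.m (val f)) (dv g) + inner ℝ (φ.m (val g)) (dv f)
    = -inner ℝ (φ.m' (val f)) (val g) := by
  refine H1_induction (p := fun f => inner ℝ (φ.m (val f)) (dv g) + inner ℝ (φ.m (val g)) (dv f)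
    = -inner ℝ (φ.m' (val f)) (val g)) (isClosed_eq (by fun_prop) (by fun_prop)) (fun ψ h => ?_) f
  refine H1_induction (p := fun g => inner ℝ (φ.m (val h.toH1)) (dv g)
    + inner ℝ (φ.m (val g)) (dv h.toH1) = -inner ℝ (φ.m' (val h.toH1)) (val g))
    (isClosed_eq (by fun_prop) (by fun_prop)) (fun χ k => ?_) g
  rw [h.val_toH1, k.val_toH1, h.dv_toH1, k.dv_toH1]
  simp only [inner_m, inner_m']
  have e : ∀ (w : ℝ → ℝ) {ψ χ : ℝ → ℝ} (h : IsTest ψ) (k : IsTest χ),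
      ∫ x, w x * (h.toL2 x * k.toL2 x) = ∫ x, w x * (ψ x * χ x) := by
    intro w ψ χ h k
    refine integral_congr_ae ?_
    filter_upwards [h.coe_toL2, k.coe_toL2] with x h1 h2
    rw [h1, h2]
  have hi : ∀ {w : ℝ → ℝ} (_ : Continuous w) {ψ χ : ℝ → ℝ} (_ : IsTest ψ) (_ : IsTest χ),
      Integrable (fun x => w x * (ψ x * χ x)) := by
    intro w hw ψ χ h k
    refine Continuous.integrable_of_hasCompactSupport ?_ ?_
    · exact hw.mul (h.continuous.mul k.continuous)
    · exact (h.2.mul_right (f' := χ)).mul_left (f := w)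
  simp only [e]
  have i1 := hi φ.continuous h k.deriv
  have i2 := hi φ.continuous k h.deriv
  have i3 := hi φ.continuous_der h k
  have h0 := integral_eq_zero_of_hasDerivAt_of_integrable
    (f := fun x => φ.toFun x * (ψ x * χ x))
    (f' := fun x => φ.toFun x * (ψ x * deriv χ x) + φ.toFun x * (χ x * deriv ψ x)
      + φ.der x * (ψ x * χ x))
    (fun x => ((φ.hasDerivAt x).mul ((h.hasDerivAt x).mul (k.hasDerivAt x))).congr_deriv
      (by simp only [Pi.mul_apply]; ring))
    ((i1.add i2).add i3) (hi φ.continuous h k)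
  rw [integral_add (f := fun x => φ.toFun x * (ψ x * deriv χ x) + φ.toFun x * (χ x * deriv ψ x))
    (i1.add i2) i3, integral_add i1 i2] at h0
  linarith

/-- The constant weight. -/
def one : Weight where
  toFun := fun _ => 1
  der := fun _ => 0
  C := 1
  hasDerivAt := fun x => hasDerivAt_const x 1
  continuous_der := continuous_const
  abs_le := by simp
  abs_der_le := by simp

end Weight

theorem inner_val_dv (f g : H1) : inner ℝ (val f) (dv g) = -inner ℝ (val g) (dv f) := by
  have := Weight.one.product_rule f g
  simp only [Weight.inner_m, Weight.inner_m', Weight.one, one_mul, zero_mul, integral_zero,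
    ← L2_inner] at this
  linarith

/-- The weighted integral of `∂ₓ (f² g)`. -/
theorem Weight.product_rule_cubic (φ : Weight) (f g : H1) :
    inner ℝ (φ.m (dv f)) (mulH f (val g)) + 1 / 2 * inner ℝ (φ.m (dv g)) (mulH f (val f))
      = -(1 / 2) * inner ℝ (φ.m' (mulH f (val f))) (val g) := by
  obtain ⟨q, h1, h2⟩ := exists_mul f f
  have h := φ.product_rule q g
  rw [h1, h2, φ.inner_m_comm (val g), map_add, inner_add_left] at h
  have e : inner ℝ (φ.m (dv f)) (mulH f (val g)) = inner ℝ (φ.m (mulH f (dv f))) (val g) := by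
    rw [φ.inner_m, φ.inner_m]
    refine integral_congr_ae ?_
    filter_upwards [coe_mulH f (val g), coe_mulH f (dv f)] with x h1 h2
    rw [h1, h2]; ring
  rw [e, φ.inner_m_comm (dv g)]
  linarith

/-! ### The resolvent `(1 - ∂ₓ²)⁻¹` -/

/-- The operator `(1 - ∂ₓ²)⁻¹ : L² → H¹`. -/
def res : L2 →L[ℝ] H1 := ContinuousLinearMap.adjoint val

/-- This is the weak form of w - w'' = g: the adjoint of the inclusion, for the H¹ inner product, is
the Riesz solution operator. -/
theorem inner_res (g : L2) (f : H1) : inner ℝ (res g) f = inner ℝ g (val f) :=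
  ContinuousLinearMap.adjoint_inner_left _ _ _

theorem norm_res_le (g : L2) : ‖res g‖ ≤ ‖g‖ := by
  by_cases h : ‖res g‖ = 0
  · rw [h]; exact norm_nonneg _
  have h1 : ‖res g‖ * ‖res g‖ ≤ ‖g‖ * ‖res g‖ := by
    rw [← real_inner_self_eq_norm_mul_norm, inner_res]
    exact (real_inner_le_norm _ _).trans (mul_le_mul_of_nonneg_left (norm_val_le _) (norm_nonneg _))
  exact le_of_mul_le_mul_right h1 (lt_of_le_of_ne (norm_nonneg _) (Ne.symm h))

/-- `∂ₓ (1 - ∂ₓ²)⁻¹ g` belongs to `H¹`, with derivative `(1 - ∂ₓ²)⁻¹ g - g`. -/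
theorem isWeakDeriv_dv_res (g : L2) : IsWeakDeriv (dv (res g)) (val (res g) - g : L2) := by
  rw [isWeakDeriv_iff_inner]
  intro ψ h
  have := inner_res g h.toH1
  rw [H1_inner, h.val_toH1, h.dv_toH1] at this
  rw [inner_sub_left]
  linarith

/-- `∂ₓ (1 - ∂ₓ²)⁻¹ g` as an element of `H¹`. -/
def dres (g : L2) : H1 := ⟨WithLp.toLp 2 (dv (res g), val (res g) - g), isWeakDeriv_dv_res g⟩

theorem val_dres (g : L2) : val (dres g) = dv (res g) := rfl

theorem dv_dres (g : L2) : dv (dres g) = val (res g) - g := rfl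

/-! ### Averages in time -/

section Average

variable {X Y : Type*} [NormedAddCommGroup X] [NormedSpace ℝ X] [NormedAddCommGroup Y]
  [NormedSpace ℝ Y]

/-- The average of `v` over `[s, s + h]`. -/
def avg (v : ℝ → X) (h s : ℝ) : X := ∫ θ in (0 : ℝ)..1, v (s + h * θ)

theorem avg_zero [CompleteSpace X] (v : ℝ → X) (s : ℝ) : avg v 0 s = v s := by simp [avg]

theorem continuous_avg {v : ℝ → X} (hv : Continuous v) :
    Continuous fun p : ℝ × ℝ => avg v p.1 p.2 := by
  refine intervalIntegral.continuous_parametric_intervalIntegral_of_continuous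
    (f := fun (p : ℝ × ℝ) θ => v (p.2 + p.1 * θ)) ?_ continuous_const
  simp only [Function.uncurry_def]
  fun_prop

theorem map_avg [CompleteSpace X] [CompleteSpace Y] (L : X →L[ℝ] Y) {v : ℝ → X}
    (hv : Continuous v) (h s : ℝ) : L (avg v h s) = avg (fun t => L (v t)) h s :=
  (L.intervalIntegral_comp_comm
    ((by fun_prop : Continuous fun θ => v (s + h * θ)).intervalIntegrable _ _)).symm

theorem avg_eq (v : ℝ → X) {h : ℝ} (hh : h ≠ 0) (s : ℝ) :
    avg v h s = h⁻¹ • ∫ t in s..s + h, v t := by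
  rw [avg, intervalIntegral.integral_comp_add_mul v hh s]
  simp

theorem hasDerivAt_avg [CompleteSpace X] {v : ℝ → X} (hv : Continuous v) {h : ℝ} (hh : h ≠ 0)
    (s : ℝ) : HasDerivAt (avg v h) (h⁻¹ • (v (s + h) - v s)) s := by
  have e : avg v h = fun s => h⁻¹ • ((∫ t in (0 : ℝ)..s + h, v t) - ∫ t in (0 : ℝ)..s, v t) := by
    funext s
    rw [avg_eq v hh, intervalIntegral.integral_interval_sub_left] <;>
      exact hv.intervalIntegrable _ _
  have hd : ∀ s, HasDerivAt (fun s => ∫ t in (0 : ℝ)..s, v t) (v s) s := fun s =>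
    intervalIntegral.integral_hasDerivAt_right (hv.intervalIntegrable _ _)
      hv.aestronglyMeasurable.stronglyMeasurableAtFilter hv.continuousAt
  rw [e]
  exact ((HasDerivAt.comp_add_const s h (hd (s + h))).sub (hd s)).const_smul h⁻¹

/-- An identity for the time derivative along all averages passes to the limit. -/
theorem integral_eq_sub_of_avg [CompleteSpace X] {V : ℝ → X} (hV : Continuous V) {Λ R : X → ℝ}
    (hΛ : Continuous Λ) (hR : Continuous R)
    (hd : ∀ h : ℝ, 0 < h → ∀ s, HasDerivAt (fun s => Λ (avg V h s)) (R (avg V h s)) s)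
    (t₁ t₂ : ℝ) : ∫ s in t₁..t₂, R (V s) = Λ (V t₂) - Λ (V t₁) := by
  have hc := continuous_avg hV
  have c1 : Continuous fun h => ∫ s in t₁..t₂, R (avg V h s) :=
    intervalIntegral.continuous_parametric_intervalIntegral_of_continuous
      (f := fun h s => R (avg V h s)) (hR.comp hc) continuous_const
  have c2 : Continuous fun h => Λ (avg V h t₂) - Λ (avg V h t₁) :=
    (hΛ.comp (hc.comp (by fun_prop : Continuous fun h : ℝ => (h, t₂)))).sub
      (hΛ.comp (hc.comp (by fun_prop : Continuous fun h : ℝ => (h, t₁))))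
  have e : ∀ h ∈ Ioi (0 : ℝ),
      ∫ s in t₁..t₂, R (avg V h s) = Λ (avg V h t₂) - Λ (avg V h t₁) := by
    intro h hh
    refine intervalIntegral.integral_eq_sub_of_hasDerivAt (fun s _ => hd h hh s) ?_
    exact (hR.comp (hc.comp (by fun_prop : Continuous fun s : ℝ => (h, s)))).intervalIntegrable _ _
  have := tendsto_nhds_unique
    ((c1.tendsto 0).mono_left (nhdsWithin_le_nhds (s := Ioi (0 : ℝ))))
    (((c2.tendsto 0).mono_left (nhdsWithin_le_nhds (s := Ioi (0 : ℝ)))).congr'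
      (by filter_upwards [self_mem_nhdsWithin] with h hh using (e h hh).symm))
  simpa only [avg_zero] using this

end Average

/-! ### Strong form of the equations -/

/-- The weak form of `(1 - ∂ₓ²) ∂ₜ f + ∂ₓ (-κ ∂ₓ² g + g + N) = 0`. -/
structure Evol (κ : ℝ) (f g : ℝ → H1) (N : ℝ → L2) : Prop where
  continuous_f : Continuous f
  continuous_g : Continuous g
  continuous_N : Continuous N
  eq : ∀ (ψ : ℝ → ℝ) (h : IsTest ψ) (t : ℝ),
    HasDerivAt (fun s => inner ℝ (val (f s)) (h.toL2 - h.deriv.deriv.toL2))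
      (-κ * inner ℝ (val (g t)) h.deriv.deriv.deriv.toL2
        + inner ℝ (val (g t) + N t) h.deriv.toL2) t

/-- Solutions of `E' + ∂ₓ (κ U + (1 - ∂ₓ²)⁻¹ ((1 - κ) U + F)) = 0` at a fixed time, where `E'` stands for
a time derivative; `DU` is the derivative of `U`. -/
structure StrongEq (κ : ℝ) (E' U DU : H1) (F : L2) : Prop where
  val_D : val DU = dv U
  eq : E' = -(κ • DU + dres ((1 - κ) • val U + F))

/-- Integrate the weak equation over [s, s + h] and use -κ ∂ₓ² + 1 = κ(1 - ∂ₓ²) + (1 - κ) to invert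
1 - ∂ₓ². Testing against (1 - ∂ₓ²)ψ determines an L² function, so the weak identity becomes an
equality in L². -/
theorem Evol.val_eq {κ : ℝ} {f g : ℝ → H1} {N : ℝ → L2} (H : Evol κ f g N) {h : ℝ} (hh : h ≠ 0)
    (s : ℝ) : val (h⁻¹ • (f (s + h) - f s)) = -(κ • dv (avg g h s)
      + dv (res ((1 - κ) • val (avg g h s) + avg N h s))) := by
  rw [← sub_eq_zero, sub_neg_eq_add]
  refine L2_eq_zero_of_test_sub _ fun ψ k => ?_
  have hg := H.continuous_g
  have hN := H.continuous_N
  have hftc : inner ℝ (val (h⁻¹ • (f (s + h) - f s))) (k.toL2 - k.deriv.deriv.toL2)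
      = -κ * inner ℝ (val (avg g h s)) k.deriv.deriv.deriv.toL2
        + inner ℝ (val (avg g h s) + avg N h s) k.deriv.toL2 := by
    have hc : Continuous fun t => -κ * inner ℝ (val (g t)) k.deriv.deriv.deriv.toL2
        + inner ℝ (val (g t) + N t) k.deriv.toL2 := by fun_prop
    have h1 := intervalIntegral.integral_eq_sub_of_hasDerivAt (a := s) (b := s + h)
      (fun t _ => H.eq ψ k t) (hc.intervalIntegrable _ _)
    rw [map_smul, map_sub, real_inner_smul_left, inner_sub_left, ← h1, ← smul_eq_mul,
      ← avg_eq _ hh]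
    have h2 := map_avg ((-κ • (innerSL ℝ k.deriv.deriv.deriv.toL2).comp
      (val.comp (ContinuousLinearMap.fst ℝ H1 L2))) + (innerSL ℝ k.deriv.toL2).comp
        (val.comp (ContinuousLinearMap.fst ℝ H1 L2) + ContinuousLinearMap.snd ℝ H1 L2))
      (hg.prodMk hN) h s
    have h3 := map_avg (ContinuousLinearMap.fst ℝ H1 L2) (hg.prodMk hN) h s
    have h4 := map_avg (ContinuousLinearMap.snd ℝ H1 L2) (hg.prodMk hN) h s
    simp only [ContinuousLinearMap.coe_fst', ContinuousLinearMap.coe_snd'] at h3 h4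
    simp only [add_apply, smul_apply,
      ContinuousLinearMap.comp_apply, ContinuousLinearMap.coe_fst', ContinuousLinearMap.coe_snd',
      innerSL_apply_apply, smul_eq_mul, h3, h4] at h2
    simp only [real_inner_comm] at h2 ⊢
    exact h2.symm
  set G := avg g h s
  set M := avg N h s
  set W := res ((1 - κ) • val G + M)
  have hW : inner ℝ W k.deriv.toH1 = _ := inner_res ((1 - κ) • val G + M) k.deriv.toH1
  rw [H1_inner, k.deriv.val_toH1, k.deriv.dv_toH1] at hW
  simp only [inner_add_left, real_inner_smul_left, inner_sub_right] at hftc hW ⊢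
  rw [inner_dv_test G k, inner_dv_test W k, inner_dv_test G k.deriv.deriv]
  linarith

/-- The gain of regularity: the difference quotient and the resolvent term are both in H¹, so as κ ≠
0 the equation can be solved for the derivative of the average, which is therefore in H¹ as well. -/
theorem Evol.exists_strongEq {κ : ℝ} (hκ : κ ≠ 0) {f g : ℝ → H1} {N : ℝ → L2} (H : Evol κ f g N)
    {h : ℝ} (hh : h ≠ 0) (s : ℝ) :
    ∃ DU, StrongEq κ (h⁻¹ • (f (s + h) - f s)) (avg g h s) DU (avg N h s) := by
  have hv := H.val_eq hh s
  set E' := h⁻¹ • (f (s + h) - f s)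
  refine ⟨-κ⁻¹ • (E' + dres ((1 - κ) • val (avg g h s) + avg N h s)), ?_, ?_⟩
  · rw [map_smul, map_add, hv, val_dres, neg_add, neg_add_cancel_right, smul_neg, neg_smul,
      neg_neg, smul_smul, inv_mul_cancel₀ hκ, one_smul]
  · rw [smul_smul, mul_neg, mul_inv_cancel₀ hκ, neg_smul, one_smul]
    abel

theorem IsSolution.evol_η {a c : ℝ} {u η : ℝ → H1} (H : IsSolution a c u η) :
    Evol (-a) η u (fun t => mulH (u t) (val (η t))) where
  continuous_f := H.continuous_η
  continuous_g := H.continuous_u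
  continuous_N := by have := H.continuous_u; have := H.continuous_η; fun_prop
  eq := by
    intro ψ h t
    have key := H.eq_η ψ h t
    have e2 : iteratedDeriv 2 ψ = deriv (deriv ψ) := by
      rw [iteratedDeriv_succ, iteratedDeriv_one]
    have e3 : iteratedDeriv 3 ψ = deriv (deriv (deriv ψ)) := by rw [iteratedDeriv_succ, e2]
    rw [e2, e3] at key
    refine (key.congr_deriv ?_).congr_of_eventuallyEq (Eventually.of_forall fun s => ?_)
    · rw [neg_neg, h.deriv.deriv.deriv.inner_toL2, h.deriv.inner_toL2, ← integral_const_mul,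
        ← integral_add ((integrable_mul_test _ h.deriv.deriv.deriv.continuous
          h.deriv.deriv.deriv.2).const_mul a) (h.deriv.integrable_mul _)]
      refine integral_congr_ae ?_
      filter_upwards [Lp.coeFn_add (val (u t)) (mulH (u t) (val (η t))),
        coe_mulH (u t) (val (η t))] with x h1 h2
      rw [h1, Pi.add_apply, h2, coe_val, coe_val]
      ring
    · change inner ℝ (val (η s)) _ = _
      rw [inner_sub_right, h.inner_toL2, h.deriv.deriv.inner_toL2,
        ← integral_sub (h.integrable_mul _) (h.deriv.deriv.integrable_mul _)]
      refine integral_congr_ae (Eventually.of_forall fun x => ?_)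
      change _ = (η s).fn x * (ψ x - deriv (deriv ψ) x)
      rw [coe_val]; ring

theorem IsSolution.evol_u {a c : ℝ} {u η : ℝ → H1} (H : IsSolution a c u η) :
    Evol (-c) u η (fun t => (1 / 2 : ℝ) • mulH (u t) (val (u t))) where
  continuous_f := H.continuous_u
  continuous_g := H.continuous_η
  continuous_N := by have := H.continuous_u; fun_prop
  eq := by
    intro ψ h t
    have key := H.eq_u ψ h t
    have e2 : iteratedDeriv 2 ψ = deriv (deriv ψ) := by
      rw [iteratedDeriv_succ, iteratedDeriv_one]
    have e3 : iteratedDeriv 3 ψ = deriv (deriv (deriv ψ)) := by rw [iteratedDeriv_succ, e2]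
    rw [e2, e3] at key
    refine (key.congr_deriv ?_).congr_of_eventuallyEq (Eventually.of_forall fun s => ?_)
    · rw [neg_neg, h.deriv.deriv.deriv.inner_toL2, h.deriv.inner_toL2, ← integral_const_mul,
        ← integral_add ((integrable_mul_test _ h.deriv.deriv.deriv.continuous
          h.deriv.deriv.deriv.2).const_mul c) (h.deriv.integrable_mul _)]
      refine integral_congr_ae ?_
      filter_upwards [Lp.coeFn_add (val (η t)) ((1 / 2 : ℝ) • mulH (u t) (val (u t))),
        Lp.coeFn_smul (1 / 2 : ℝ) (mulH (u t) (val (u t))),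
        coe_mulH (u t) (val (u t))] with x h1 h2 h3
      rw [h1, Pi.add_apply, h2, Pi.smul_apply, h3, coe_val, coe_val, smul_eq_mul]
      ring
    · change inner ℝ (val (u s)) _ = _
      rw [inner_sub_right, h.inner_toL2, h.deriv.deriv.inner_toL2,
        ← integral_sub (h.integrable_mul _) (h.deriv.deriv.integrable_mul _)]
      refine integral_congr_ae (Eventually.of_forall fun x => ?_)
      change _ = (u s).fn x * (ψ x - deriv (deriv ψ) x)
      rw [coe_val]; ring

/-! ### Functionals along solutions -/

/-- To obtain an integrated identity for a rough solution it suffices to differentiate Λ along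
H¹-differentiable curves. There F and G must be arbitrary, because the average of a product is not
the product of the averages; they become u η and u²/2 only in the limit. -/
theorem IsSolution.integral_identity {a c : ℝ} (ha : -a ≠ 0) (hc : -c ≠ 0) {u η : ℝ → H1}
    (H : IsSolution a c u η) {Λ : H1 × H1 → ℝ} {R : H1 × H1 × L2 × L2 → ℝ} (hΛ : Continuous Λ)
    (hR : Continuous R)
    (hd : ∀ (U E : ℝ → H1) (U' E' DU DE : H1) (F G : L2) (s : ℝ), HasDerivAt U U' s →
      HasDerivAt E E' s → StrongEq (-a) E' (U s) DU F → StrongEq (-c) U' (E s) DE G →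
      HasDerivAt (fun s => Λ (U s, E s)) (R (U s, E s, F, G)) s) (t₁ t₂ : ℝ) :
    ∫ s in t₁..t₂, R (u s, η s, mulH (u s) (val (η s)), (1 / 2 : ℝ) • mulH (u s) (val (u s)))
      = Λ (u t₂, η t₂) - Λ (u t₁, η t₁) := by
  have hη := H.evol_η
  have hu := H.evol_u
  set V : ℝ → H1 × H1 × L2 × L2 := fun s =>
    (u s, η s, mulH (u s) (val (η s)), (1 / 2 : ℝ) • mulH (u s) (val (u s)))
  have hV : Continuous V := by
    exact H.continuous_u.prodMk (H.continuous_η.prodMk (hη.continuous_N.prodMk hu.continuous_N))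
  refine integral_eq_sub_of_avg hV (Λ := fun x : H1 × H1 × L2 × L2 => Λ (x.1, x.2.1)) (R := R) (by fun_prop) hR ?_ t₁ t₂
  intro h hh s
  have e : ∀ s, avg V h s = (avg u h s, avg η h s, avg (fun s => mulH (u s) (val (η s))) h s,
      avg (fun s => (1 / 2 : ℝ) • mulH (u s) (val (u s))) h s) := fun s =>
    Prod.ext (map_avg (ContinuousLinearMap.fst ℝ H1 (H1 × L2 × L2)) hV h s)
      (Prod.ext (map_avg ((ContinuousLinearMap.fst ℝ H1 (L2 × L2)).comp
          (ContinuousLinearMap.snd ℝ H1 (H1 × L2 × L2))) hV h s)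
        (Prod.ext (map_avg ((ContinuousLinearMap.fst ℝ L2 L2).comp
          ((ContinuousLinearMap.snd ℝ H1 (L2 × L2)).comp
            (ContinuousLinearMap.snd ℝ H1 (H1 × L2 × L2)))) hV h s)
          (map_avg ((ContinuousLinearMap.snd ℝ L2 L2).comp
          ((ContinuousLinearMap.snd ℝ H1 (L2 × L2)).comp
            (ContinuousLinearMap.snd ℝ H1 (H1 × L2 × L2)))) hV h s)))
  obtain ⟨DU, h1⟩ := hη.exists_strongEq ha hh.ne' s
  obtain ⟨DE, h2⟩ := hu.exists_strongEq hc hh.ne' s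
  simp only [e]
  exact hd _ _ _ _ _ _ _ _ s (hasDerivAt_avg H.continuous_u hh.ne' s)
    (hasDerivAt_avg H.continuous_η hh.ne' s) h1 h2

theorem hasDerivAt_clm {X Y : Type*} [NormedAddCommGroup X] [NormedSpace ℝ X] [NormedAddCommGroup Y]
    [NormedSpace ℝ Y] (L : X →L[ℝ] Y) {U : ℝ → X} {U' : X} {s : ℝ} (h : HasDerivAt U U' s) :
    HasDerivAt (fun s => L (U s)) (L U') s :=
  L.hasFDerivAt.comp_hasDerivAt s h

/-- The Hamiltonian. -/
def energy (α β : ℝ) (x : H1 × H1) : ℝ :=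
  1 / 2 * (α * inner ℝ (dv x.1) (dv x.1) + inner ℝ (val x.1) (val x.1)
    + β * inner ℝ (dv x.2) (dv x.2) + inner ℝ (val x.2) (val x.2)
    + inner ℝ (mulH x.1 (val x.1)) (val x.2))

/-- The potential in the equation of `StrongEq`. -/
def StrongEq.pot (κ : ℝ) (U : H1) (F : L2) : H1 := κ • U + res ((1 - κ) • val U + F)

/-- The potential is an H¹ gradient: its pairing with f is the first variation of ½∫(κ Uₓ² + U²) in
the direction f, plus ∫ F f. -/
theorem StrongEq.inner_pot (κ : ℝ) (U f : H1) (F : L2) :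
    inner ℝ (StrongEq.pot κ U F) f
      = κ * inner ℝ (dv U) (dv f) + inner ℝ (val U) (val f) + inner ℝ F (val f) := by
  rw [StrongEq.pot, inner_add_left, inner_res, H1_inner, map_smul, map_smul, inner_add_left,
    real_inner_smul_left, real_inner_smul_left, real_inner_smul_left]
  ring

theorem StrongEq.dv_pot (κ : ℝ) (U : H1) (F : L2) :
    dv (StrongEq.pot κ U F) = κ • dv U + dv (res ((1 - κ) • val U + F)) := by
  rw [StrongEq.pot, map_add dv, map_smul dv]

theorem StrongEq.val_eq {κ : ℝ} {E' U DU : H1} {F : L2} (h : StrongEq κ E' U DU F) :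
    val E' = -dv (StrongEq.pot κ U F) := by
  rw [h.eq, map_neg, map_add, map_smul, h.val_D, val_dres, StrongEq.dv_pot]

/-- `∂ₓ` is skew-adjoint. -/
theorem inner_skew {X Y X' Y' : H1} (hX : val X' = dv X) (hY : val Y' = dv Y) :
    inner ℝ X Y' + inner ℝ Y X' = 0 := by
  rw [H1_inner, H1_inner, hX, hY, inner_val_dv X Y, ← hX, ← hY, inner_val_dv X' Y']
  ring

/-- Hamiltonian structure: the H¹ gradients pair with their own x-derivatives and cancel by
`inner_skew`. What remains is the error of replacing the products U E and U²/2 by F and G. -/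
theorem energy_hasDerivAt {α β : ℝ} (U E : ℝ → H1) (U' E' DU DE : H1) (F G : L2) (s : ℝ)
    (hU : HasDerivAt U U' s) (hE : HasDerivAt E E' s) (h1 : StrongEq α E' (U s) DU F)
    (h2 : StrongEq β U' (E s) DE G) :
    HasDerivAt (fun s => energy α β (U s, E s))
      (-inner ℝ (mulH (U s) (val (E s)) - F) (dv (StrongEq.pot β (E s) G))
        - inner ℝ ((1 / 2 : ℝ) • mulH (U s) (val (U s)) - G) (dv (StrongEq.pot α (U s) F))) s := by
  have vU := hasDerivAt_clm val hU
  have vE := hasDerivAt_clm val hE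
  have dU := hasDerivAt_clm dv hU
  have dE := hasDerivAt_clm dv hE
  have key := (((((dU.inner ℝ dU).const_mul α).add (vU.inner ℝ vU)).add
    ((dE.inner ℝ dE).const_mul β)).add (vE.inner ℝ vE)).add
      (((hasDerivAt_clm mulH hU).clm_apply vU).inner ℝ vE)
  refine (key.const_mul (1 / 2)).congr_deriv ?_
  have hX : val (α • DU + dres ((1 - α) • val (U s) + F)) = dv (StrongEq.pot α (U s) F) := by
    rw [map_add, map_smul, h1.val_D, val_dres, StrongEq.dv_pot]
  have hY : val (β • DE + dres ((1 - β) • val (E s) + G)) = dv (StrongEq.pot β (E s) G) := by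
    rw [map_add, map_smul, h2.val_D, val_dres, StrongEq.dv_pot]
  have sk := inner_skew hX hY
  have p1 := StrongEq.inner_pot α (U s) U' F
  have p2 := StrongEq.inner_pot β (E s) E' G
  rw [h2.eq, inner_neg_right, ← h2.eq] at p1
  rw [h1.eq, inner_neg_right, ← h1.eq] at p2
  have e1 : inner ℝ (mulH (U s) (val U')) (val (E s)) = inner ℝ (mulH (U s) (val (E s))) (val U') :=
    inner_mulH_comm _ _ _
  have e2 : inner ℝ (mulH U' (val (U s))) (val (E s)) = inner ℝ (mulH (U s) (val (E s))) (val U') := by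
    rw [mulH_comm, e1]
  have q1 : dv (StrongEq.pot β (E s) G) = -val U' := by rw [h2.val_eq, neg_neg]
  have q2 : dv (StrongEq.pot α (U s) F) = -val E' := by rw [h1.val_eq, neg_neg]
  rw [q1, q2]
  simp only [inner_add_left, inner_sub_left, inner_neg_right, real_inner_smul_left, e1, e2]
  rw [real_inner_comm (dv (U s)) (dv U'), real_inner_comm (val (U s)) (val U'),
    real_inner_comm (dv (E s)) (dv E'), real_inner_comm (val (E s)) (val E')]
  linarith

theorem continuous_energy (α β : ℝ) : Continuous (energy α β) := by
  unfold energy; fun_prop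

theorem IsSolution.energy_eq {a c : ℝ} (ha : -a ≠ 0) (hc : -c ≠ 0) {u η : ℝ → H1}
    (H : IsSolution a c u η) (t₁ t₂ : ℝ) :
    energy (-a) (-c) (u t₁, η t₁) = energy (-a) (-c) (u t₂, η t₂) := by
  have := H.integral_identity ha hc (Λ := energy (-a) (-c))
    (R := fun x : H1 × H1 × L2 × L2 => -inner ℝ (mulH x.1 (val x.2.1) - x.2.2.1) (dv (StrongEq.pot (-c) x.2.1 x.2.2.2))
        - inner ℝ ((1 / 2 : ℝ) • mulH x.1 (val x.1) - x.2.2.2) (dv (StrongEq.pot (-a) x.1 x.2.2.1)))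
    (continuous_energy _ _) (by unfold StrongEq.pot; fun_prop) energy_hasDerivAt t₁ t₂
  simp only [sub_self, inner_zero_left, neg_zero, intervalIntegral.integral_zero] at this
  linarith

/-- The time derivative of `∫ u ∂ₓη`. -/
theorem current_hasDerivAt {α β : ℝ} (U E : ℝ → H1) (U' E' DU DE : H1) (F G : L2) (s : ℝ)
    (hU : HasDerivAt U U' s) (hE : HasDerivAt E E' s) (h1 : StrongEq α E' (U s) DU F)
    (h2 : StrongEq β U' (E s) DE G) :
    HasDerivAt (fun s => inner ℝ (val (U s)) (dv (E s)))
      (inner ℝ (dv (U s)) (dv (StrongEq.pot α (U s) F))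
        - inner ℝ (dv (E s)) (dv (StrongEq.pot β (E s) G))) s := by
  refine ((hasDerivAt_clm val hU).inner ℝ (hasDerivAt_clm dv hE)).congr_deriv ?_
  have q1 : dv (StrongEq.pot β (E s) G) = -val U' := by rw [h2.val_eq, neg_neg]
  have q2 : dv (StrongEq.pot α (U s) F) = -val E' := by rw [h1.val_eq, neg_neg]
  rw [q1, q2, inner_val_dv (U s) E', inner_neg_right, inner_neg_right,
    real_inner_comm (dv (U s)), real_inner_comm (dv (E s))]
  ring

/-- The quadratic part of the momentum flux of one component; `m` is multiplication by the derivative of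
the weight. -/
def flux (m : L2 →L[ℝ] L2) (κ : ℝ) (U : H1) (F : L2) : ℝ :=
  (κ - 1 / 2) * inner ℝ (m (val U)) (val U)
    + inner ℝ (m (val U)) (val (res ((1 - κ) • val U + F))) + κ / 2 * inner ℝ (m (dv U)) (dv U)

/-- Every quadratic term is φ times an exact derivative, so integration by parts moves the
derivative to φ. Applying the product rule to `DU` with itself is where the H² regularity enters. -/
theorem StrongEq.momentum_eq {κ : ℝ} {E' U DU : H1} {F : L2} (h : StrongEq κ E' U DU F)
    (φ : Weight) : inner ℝ (φ.m (val U)) (val E') + inner ℝ (φ.m (dv U)) (dv E')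
      = flux φ.m' κ U F + inner ℝ (φ.m (dv U)) F := by
  set W := res ((1 - κ) • val U + F) with hWdef
  have e1 : val E' = -(κ • dv U + dv W) := by rw [h.eq, map_neg, map_add, map_smul, h.val_D, val_dres]
  have e2 : dv E' = -(κ • dv DU + (val W - ((1 - κ) • val U + F))) := by
    rw [h.eq, map_neg, map_add, map_smul, dv_dres]
  have r1 := φ.product_rule U U
  have r2 := φ.product_rule U W
  have r3 := φ.product_rule DU DU
  rw [h.val_D] at r3
  rw [φ.inner_m_comm (val W)] at r2
  have r4 := φ.inner_m_comm (val U) (dv U)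
  rw [flux, ← hWdef, e1, e2]
  simp only [inner_neg_right, inner_add_right, inner_sub_right, real_inner_smul_right]
  linear_combination (-κ / 2 + (1 - κ) / 2) * r1 - r2 - κ / 2 * r3 - (1 - κ) * r4

theorem momentum_hasDerivAt (φ : Weight) {α β : ℝ} (U E : ℝ → H1) (U' E' DU DE : H1) (F G : L2)
    (s : ℝ) (hU : HasDerivAt U U' s) (hE : HasDerivAt E E' s) (h1 : StrongEq α E' (U s) DU F)
    (h2 : StrongEq β U' (E s) DE G) :
    HasDerivAt (fun s => inner ℝ (φ.m (val (U s))) (val (E s)) + inner ℝ (φ.m (dv (U s))) (dv (E s)))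
      (flux φ.m' α (U s) F + inner ℝ (φ.m (dv (U s))) F
        + (flux φ.m' β (E s) G + inner ℝ (φ.m (dv (E s))) G)) s := by
  rw [← h1.momentum_eq, ← h2.momentum_eq]
  refine (((hasDerivAt_clm φ.m (hasDerivAt_clm val hU)).inner ℝ (hasDerivAt_clm val hE)).add
    ((hasDerivAt_clm φ.m (hasDerivAt_clm dv hU)).inner ℝ (hasDerivAt_clm dv hE))).congr_deriv ?_
  rw [φ.inner_m_comm (val U'), φ.inner_m_comm (dv U')]
  ring

/-- The virial identity for periodic solutions. -/
theorem IsSolution.integral_flux {a c : ℝ} (ha : -a ≠ 0) (hc : -c ≠ 0) {u η : ℝ → H1}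
    (H : IsSolution a c u η) {P : ℝ} (hu : u P = u 0) (hη : η P = η 0) (φ : Weight) :
    ∫ s in (0 : ℝ)..P, (flux φ.m' (-a) (u s) (mulH (u s) (val (η s)))
      + flux φ.m' (-c) (η s) ((1 / 2 : ℝ) • mulH (u s) (val (u s)))
      - 1 / 2 * inner ℝ (φ.m' (mulH (u s) (val (u s)))) (val (η s))) = 0 := by
  have := H.integral_identity ha hc
    (Λ := fun x : H1 × H1 => inner ℝ (φ.m (val x.1)) (val x.2) + inner ℝ (φ.m (dv x.1)) (dv x.2))
    (R := fun x : H1 × H1 × L2 × L2 => flux φ.m' (-a) x.1 x.2.2.1 + inner ℝ (φ.m (dv x.1)) x.2.2.1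
        + (flux φ.m' (-c) x.2.1 x.2.2.2 + inner ℝ (φ.m (dv x.2.1)) x.2.2.2))
    (by fun_prop) (by unfold flux; fun_prop) (momentum_hasDerivAt φ) 0 P
  rw [hu, hη, sub_self] at this
  refine Eq.trans (intervalIntegral.integral_congr fun s _ => ?_) this
  -- Once F = u η and G = u²/2, the two leftover cubic terms form φ ∂ₓ(u² η)/2.
  have h := φ.product_rule_cubic (u s) (η s)
  simp only [real_inner_smul_right]
  linarith

theorem IsSolution.integral_current {a c : ℝ} (ha : -a ≠ 0) (hc : -c ≠ 0) {u η : ℝ → H1}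
    (H : IsSolution a c u η) {P : ℝ} (hu : u P = u 0) (hη : η P = η 0) :
    ∫ s in (0 : ℝ)..P, (inner ℝ (dv (u s)) (dv (StrongEq.pot (-a) (u s) (mulH (u s) (val (η s)))))
      - inner ℝ (dv (η s)) (dv (StrongEq.pot (-c) (η s) ((1 / 2 : ℝ) • mulH (u s) (val (u s))))))
      = 0 := by
  have := H.integral_identity ha hc (Λ := fun x : H1 × H1 => inner ℝ (val x.1) (dv x.2))
    (R := fun x : H1 × H1 × L2 × L2 => inner ℝ (dv x.1) (dv (StrongEq.pot (-a) x.1 x.2.2.1))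
      - inner ℝ (dv x.2.1) (dv (StrongEq.pot (-c) x.2.1 x.2.2.2)))
    (by fun_prop) (by unfold StrongEq.pot; fun_prop) current_hasDerivAt 0 P
  rwa [hu, hη, sub_self] at this

/-! ### Removing the weight -/

/-- The weight `n arctan (x / n)`, with `n + 1` in place of `n`. -/
def arctanWeight (n : ℕ) : Weight where
  toFun x := (n + 1) * Real.arctan (x / (n + 1))
  der x := 1 / (1 + (x / (n + 1)) ^ 2)
  C := 2 * (n + 1)
  hasDerivAt x := by
    have h := (((hasDerivAt_id x).div_const ((n : ℝ) + 1)).arctan).const_mul ((n : ℝ) + 1)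
    refine h.congr_deriv ?_
    have : (n : ℝ) + 1 ≠ 0 := by positivity
    simp only [id]
    field_simp
  continuous_der := by
    refine continuous_const.div (by fun_prop) fun x => ?_
    positivity
  abs_le x := by
    have h : |Real.arctan (x / (n + 1))| ≤ 2 := by
      rw [abs_le]
      have := Real.pi_le_four
      constructor
      · linarith [Real.neg_pi_div_two_lt_arctan (x / (n + 1))]
      · linarith [Real.arctan_lt_pi_div_two (x / (n + 1))]
    rw [abs_mul, abs_of_nonneg (by positivity : (0 : ℝ) ≤ n + 1), mul_comm]
    exact mul_le_mul_of_nonneg_right h (by positivity)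
  abs_der_le x := by
    rw [abs_of_nonneg (by positivity), div_le_iff₀ (by positivity)]
    have : (0 : ℝ) ≤ n := n.cast_nonneg
    nlinarith [sq_nonneg (x / ((n : ℝ) + 1))]

/-- The common bound `C` grows with n; dominated convergence needs this uniform one. -/
theorem abs_arctanWeight_der_le (n : ℕ) (x : ℝ) : |(arctanWeight n).der x| ≤ 1 := by
  change |1 / (1 + (x / ((n : ℝ) + 1)) ^ 2)| ≤ 1
  rw [abs_of_nonneg (by positivity), div_le_iff₀ (by positivity)]
  nlinarith [sq_nonneg (x / ((n : ℝ) + 1))]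

theorem tendsto_arctanWeight_der (x : ℝ) :
    Tendsto (fun n => (arctanWeight n).der x) atTop (𝓝 1) := by
  change Tendsto (fun n : ℕ => 1 / (1 + (x / ((n : ℝ) + 1)) ^ 2)) atTop (𝓝 1)
  have h : Tendsto (fun n : ℕ => x / ((n : ℝ) + 1)) atTop (𝓝 0) :=
    tendsto_const_nhds.div_atTop (tendsto_natCast_atTop_atTop.atTop_add tendsto_const_nhds)
  have h2 := (tendsto_const_nhds (x := (1 : ℝ))).div
    ((tendsto_const_nhds (x := (1 : ℝ))).add (h.pow 2)) (by norm_num)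
  simpa [Pi.div_def] using h2

theorem tendsto_inner_arctanWeight (f g : L2) :
    Tendsto (fun n => inner ℝ ((arctanWeight n).m' f) g) atTop (𝓝 (inner ℝ f g)) := by
  simp only [Weight.inner_m', L2_inner f g]
  refine tendsto_integral_of_dominated_convergence (fun x => ‖f x * g x‖) (fun n => ?_)
    (L2_integrable_mul f g).norm (fun n => Eventually.of_forall fun x => ?_)
    (Eventually.of_forall fun x => ?_)
  · exact (arctanWeight n).continuous_der.aestronglyMeasurable.mul
      (L2_integrable_mul f g).aestronglyMeasurable
  · rw [norm_mul]
    exact mul_le_of_le_one_left (norm_nonneg _) (abs_arctanWeight_der_le n x)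
  · simpa using (tendsto_arctanWeight_der x).mul_const (f x * g x)

theorem abs_inner_arctanWeight_le (n : ℕ) (f g : L2) :
    |inner ℝ ((arctanWeight n).m' f) g| ≤ ‖f‖ * ‖g‖ := by
  refine (abs_real_inner_le_norm _ _).trans (mul_le_mul_of_nonneg_right ?_ (norm_nonneg _))
  rw [← one_mul ‖f‖]
  refine Lp.norm_le_mul_norm_of_ae_le_mul ?_
  filter_upwards [coe_mulBdd (arctanWeight n).continuous_der.aestronglyMeasurable
    (Eventually.of_forall (arctanWeight n).abs_der_le) f] with x hx
  rw [Weight.m', hx, norm_mul]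
  exact mul_le_mul_of_nonneg_right (abs_arctanWeight_der_le n x) (norm_nonneg _)

theorem tendsto_flux_arctanWeight (κ : ℝ) (U : H1) (F : L2) :
    Tendsto (fun n => flux (arctanWeight n).m' κ U F) atTop
      (𝓝 (flux (ContinuousLinearMap.id ℝ L2) κ U F)) :=
  (((tendsto_inner_arctanWeight _ _).const_mul _).add (tendsto_inner_arctanWeight _ _)).add
    ((tendsto_inner_arctanWeight _ _).const_mul _)

theorem abs_flux_arctanWeight_le (n : ℕ) (κ : ℝ) (U : H1) (F : L2) :
    |flux (arctanWeight n).m' κ U F| ≤ |κ - 1 / 2| * (‖val U‖ * ‖val U‖)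
      + ‖val U‖ * ‖val (res ((1 - κ) • val U + F))‖ + |κ / 2| * (‖dv U‖ * ‖dv U‖) := by
  refine (abs_add_three _ _ _).trans ?_
  rw [abs_mul, abs_mul]
  gcongr <;> exact abs_inner_arctanWeight_le _ _ _

/-- The weighted momentum need not stay bounded as n → ∞, but periodicity has already removed it for
each n. Only fluxes remain, dominated independently of n. -/
theorem IsSolution.integral_flux_id {a c : ℝ} (ha : -a ≠ 0) (hc : -c ≠ 0) {u η : ℝ → H1}
    (H : IsSolution a c u η) {P : ℝ} (hu : u P = u 0) (hη : η P = η 0) :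
    ∫ s in (0 : ℝ)..P, (flux (ContinuousLinearMap.id ℝ L2) (-a) (u s) (mulH (u s) (val (η s)))
      + flux (ContinuousLinearMap.id ℝ L2) (-c) (η s) ((1 / 2 : ℝ) • mulH (u s) (val (u s)))
      - 1 / 2 * inner ℝ (mulH (u s) (val (u s))) (val (η s))) = 0 := by
  have cu := H.continuous_u
  have cη := H.continuous_η
  let b (κ : ℝ) (U : H1) (F : L2) : ℝ := |κ - 1 / 2| * (‖val U‖ * ‖val U‖)
      + ‖val U‖ * ‖val (res ((1 - κ) • val U + F))‖ + |κ / 2| * (‖dv U‖ * ‖dv U‖)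
  have hlim := intervalIntegral.tendsto_integral_filter_of_dominated_convergence
    (μ := volume) (a := 0) (b := P) (l := atTop)
    (F := fun (n : ℕ) s => flux (arctanWeight n).m' (-a) (u s) (mulH (u s) (val (η s)))
      + flux (arctanWeight n).m' (-c) (η s) ((1 / 2 : ℝ) • mulH (u s) (val (u s)))
      - 1 / 2 * inner ℝ ((arctanWeight n).m' (mulH (u s) (val (u s)))) (val (η s)))
    (f := fun s => flux (ContinuousLinearMap.id ℝ L2) (-a) (u s) (mulH (u s) (val (η s)))
      + flux (ContinuousLinearMap.id ℝ L2) (-c) (η s) ((1 / 2 : ℝ) • mulH (u s) (val (u s)))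
      - 1 / 2 * inner ℝ (mulH (u s) (val (u s))) (val (η s)))
    (fun s => b (-a) (u s) (mulH (u s) (val (η s)))
      + b (-c) (η s) ((1 / 2 : ℝ) • mulH (u s) (val (u s)))
      + 1 / 2 * (‖mulH (u s) (val (u s))‖ * ‖val (η s)‖))
    (Eventually.of_forall fun n => Continuous.aestronglyMeasurable (by unfold flux; fun_prop))
    (Eventually.of_forall fun n => Eventually.of_forall fun s _ => by
      refine (abs_sub _ _).trans (add_le_add ((abs_add_le _ _).trans (add_le_add ?_ ?_)) ?_)
      · exact abs_flux_arctanWeight_le _ _ _ _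
      · exact abs_flux_arctanWeight_le _ _ _ _
      · rw [abs_mul, abs_of_nonneg (by norm_num : (0 : ℝ) ≤ 1 / 2)]
        exact mul_le_mul_of_nonneg_left (abs_inner_arctanWeight_le _ _ _) (by norm_num))
    (Continuous.intervalIntegrable (by fun_prop) _ _)
    (Eventually.of_forall fun s _ => ((tendsto_flux_arctanWeight _ _ _).add
      (tendsto_flux_arctanWeight _ _ _)).sub ((tendsto_inner_arctanWeight _ _).const_mul _))
  simp only [H.integral_flux ha hc hu hη] at hlim
  exact (tendsto_nhds_unique hlim tendsto_const_nhds)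

/-! ### Coercivity -/

/-- The virial form of one component, with parameter `p`. -/
def virialForm (κ p : ℝ) (U : H1) (F : L2) : ℝ :=
  flux (ContinuousLinearMap.id ℝ L2) κ U F
    + (p - 1) / 2 * inner ℝ (dv U) (dv (StrongEq.pot κ U F))

/-- With f = (1 - ∂ₓ²)⁻¹ U, the part without F is half of |f|² + (3κ - 1 + p)|f'|² + (κp + 3κ - 2 +
p)|f''|² + κp|f'''|² in L² norms, while ‖U‖² has coefficients 1, 3, 3, 1. Comparing coefficients
gives the four conditions on μ; the terms with F cost at most 2‖U‖‖F‖. -/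
theorem virialForm_ge {κ p μ : ℝ} (hp0 : 0 ≤ p) (hp2 : p ≤ 2) (h0 : 2 * μ ≤ 1)
    (h1 : 6 * μ ≤ 3 * κ - 1 + p) (h2 : 6 * μ ≤ κ * p + 3 * κ - 2 + p) (h3 : 2 * μ ≤ κ * p)
    (U : H1) (F : L2) : μ * ‖U‖ ^ 2 - 2 * (‖U‖ * ‖F‖) ≤ virialForm κ p U F := by
  set f := res (val U) with hf
  have a1 : inner ℝ (val f) (val f) + inner ℝ (dv f) (dv f) = inner ℝ (val U) (val f) := by
    rw [← H1_inner, hf, inner_res]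
  have a2 : inner ℝ (val f) (val U) + inner ℝ (dv f) (dv U) = inner ℝ (val U) (val U) := by
    rw [← H1_inner, hf, inner_res]
  have n0 : 0 ≤ inner ℝ (val f) (val f) := real_inner_self_nonneg
  have n1 : 0 ≤ inner ℝ (dv f) (dv f) := real_inner_self_nonneg
  -- Since U - f = -f'', this and the next quantity are the squared L² norms of f'' and f'''.
  have n2 : 0 ≤ inner ℝ (val U - val f) (val U - val f) := real_inner_self_nonneg
  have n3 : 0 ≤ inner ℝ (dv U - dv f) (dv U - dv f) := real_inner_self_nonneg
  have b1 : |inner ℝ (val U) (val (res F))| ≤ ‖U‖ * ‖F‖ :=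
    (abs_real_inner_le_norm _ _).trans (mul_le_mul (norm_val_le U)
      ((norm_val_le _).trans (norm_res_le F)) (norm_nonneg _) (norm_nonneg _))
  have b2 : |inner ℝ (dv U) (dv (res F))| ≤ ‖U‖ * ‖F‖ :=
    (abs_real_inner_le_norm _ _).trans (mul_le_mul (norm_dv_le U)
      ((norm_dv_le _).trans (norm_res_le F)) (norm_nonneg _) (norm_nonneg _))
  have b3 : |(p - 1) / 2 * inner ℝ (dv U) (dv (res F))| ≤ ‖U‖ * ‖F‖ := by
    rw [abs_mul]
    refine (mul_le_of_le_one_left (abs_nonneg _) ?_).trans b2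
    rw [abs_le]; constructor <;> linarith
  have e : virialForm κ p U F = (κ - 1 / 2) * inner ℝ (val U) (val U)
      + ((1 - κ) * inner ℝ (val U) (val f) + inner ℝ (val U) (val (res F)))
      + κ / 2 * inner ℝ (dv U) (dv U)
      + ((p - 1) / 2 * (κ * inner ℝ (dv U) (dv U) + (1 - κ) * inner ℝ (dv U) (dv f))
        + (p - 1) / 2 * inner ℝ (dv U) (dv (res F))) := by
    rw [virialForm, flux, StrongEq.dv_pot, map_add res, map_smul res, map_add val, map_smul val,
      map_add dv, map_smul dv]
    simp only [ContinuousLinearMap.id_apply, inner_add_right, real_inner_smul_right]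
    ring
  rw [← real_inner_self_eq_norm_sq, H1_inner, e]
  simp only [inner_sub_left, inner_sub_right] at n2 n3
  rw [real_inner_comm (val U) (val f)] at a2
  rw [real_inner_comm (dv U) (dv f)] at a2
  rw [real_inner_comm (val U) (val f)] at n2
  rw [real_inner_comm (dv U) (dv f)] at n3
  have l1 := (abs_le.1 b1).1
  have l3 := (abs_le.1 b3).1
  have m0 := mul_nonneg (sub_nonneg.2 h0) n0
  have m1 := mul_nonneg (sub_nonneg.2 h1) n1
  have m2 := mul_nonneg (sub_nonneg.2 h2) n2
  have m3 := mul_nonneg (sub_nonneg.2 h3) n3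
  generalize inner ℝ (val U) (val (res F)) = t1 at *
  generalize (p - 1) / 2 * inner ℝ (dv U) (dv (res F)) = t3 at *
  generalize inner ℝ (val U) (val U) = x1 at *
  generalize inner ℝ (dv U) (dv U) = x2 at *
  generalize inner ℝ (val U) (val f) = x3 at *
  generalize inner ℝ (dv U) (dv f) = x4 at *
  generalize inner ℝ (val f) (val f) = x5 at *
  generalize inner ℝ (dv f) (dv f) = x6 at *
  obtain rfl : x3 = x5 + x6 := a1.symm
  obtain rfl : x1 = x5 + x6 + x4 := a2.symm
  nlinarith

/-- The f'' conditions require p > (2 - 3α)/(1 + α) and 2 - p > (2 - 3β)/(1 + β). The two lower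
bounds have sum less than 2 exactly when 2 < 3(α + β) + 8αβ. -/
theorem exists_coercive {α β : ℝ} (hα : 0 < α) (hβ : 0 < β)
    (h : 2 < 3 * (α + β) + 8 * (α * β)) :
    ∃ p μ : ℝ, 0 < μ ∧ 0 ≤ p ∧ p ≤ 2 ∧ 2 * μ ≤ 1 ∧
      6 * μ ≤ 3 * α - 1 + p ∧ 6 * μ ≤ α * p + 3 * α - 2 + p ∧ 2 * μ ≤ α * p ∧
      6 * μ ≤ 3 * β - 1 + (2 - p) ∧ 6 * μ ≤ β * (2 - p) + 3 * β - 2 + (2 - p) ∧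
      2 * μ ≤ β * (2 - p) := by
  have hlt : max 0 ((2 - 3 * α) / (1 + α)) < min 2 (2 - (2 - 3 * β) / (1 + β)) := by
    have hα1 : (2 - 3 * α) / (1 + α) < 2 := by rw [div_lt_iff₀ (by linarith)]; linarith
    have hβ1 : (2 - 3 * β) / (1 + β) < 2 := by rw [div_lt_iff₀ (by linarith)]; linarith
    refine max_lt (lt_min (by norm_num) (by linarith)) (lt_min hα1 ?_)
    rw [lt_sub_iff_add_lt, div_add_div _ _ (by linarith) (by linarith),
      div_lt_iff₀ (by positivity)]
    nlinarith
  obtain ⟨p, h1, h2⟩ := exists_between hlt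
  obtain ⟨p0, pa⟩ := max_lt_iff.1 h1
  obtain ⟨p2, pb⟩ := lt_min_iff.1 h2
  rw [div_lt_iff₀ (by linarith)] at pa
  rw [lt_sub_comm, div_lt_iff₀ (by linarith)] at pb
  -- The f' condition follows from the f'' one: multiplied by 1 + α, the expression exceeds 3α² - α
  -- + 1 > 0.
  have k1 : 0 < 3 * α - 1 + p := by nlinarith [sq_nonneg (α - 1)]
  have k2 : 0 < α * p + 3 * α - 2 + p := by linarith
  have k3 : 0 < α * p := by positivity
  have k4 : 0 < 3 * β - 1 + (2 - p) := by nlinarith [sq_nonneg (β - 1)]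
  have k5 : 0 < β * (2 - p) + 3 * β - 2 + (2 - p) := by linarith
  have k6 : 0 < β * (2 - p) := mul_pos hβ (by linarith)
  have k0 : (0 : ℝ) < 1 := one_pos
  obtain ⟨μ, hμ, hμ'⟩ := exists_between (lt_min k0 (lt_min (lt_min k1 (lt_min k2 k3))
    (lt_min k4 (lt_min k5 k6))))
  simp only [lt_min_iff] at hμ'
  obtain ⟨j0, ⟨j1, j2, j3⟩, j4, j5, j6⟩ := hμ'
  exact ⟨p, μ / 6, by linarith, by linarith, by linarith, by linarith, by linarith, by linarith,
    by linarith, by linarith, by linarith, by linarith⟩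

theorem abs_inner_mulH_le (f : H1) (g k : L2) : |inner ℝ (mulH f g) k| ≤ ‖f‖ * ‖g‖ * ‖k‖ :=
  (abs_real_inner_le_norm _ _).trans (mul_le_mul_of_nonneg_right (norm_mulH_le f g) (norm_nonneg _))

/-- The cubic terms total at most (2 + 1 + 1/2)‖U‖²‖E‖. The radius μ/8 makes this at most
(7/16)μ‖U‖², below half of the quadratic lower bound. -/
theorem virial_ge {α β p q μ : ℝ}
    (h1 : ∀ U F, μ * ‖U‖ ^ 2 - 2 * (‖U‖ * ‖F‖) ≤ virialForm α p U F)
    (h2 : ∀ U F, μ * ‖U‖ ^ 2 - 2 * (‖U‖ * ‖F‖) ≤ virialForm β q U F) (hμ : 0 < μ) {U E : H1}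
    (hs : ‖U‖ ^ 2 + ‖E‖ ^ 2 ≤ (μ / 8) ^ 2) :
    μ / 2 * (‖U‖ ^ 2 + ‖E‖ ^ 2) ≤ virialForm α p U (mulH U (val E))
      + virialForm β q E ((1 / 2 : ℝ) • mulH U (val U))
      - 1 / 2 * inner ℝ (mulH U (val U)) (val E) := by
  have v1 := h1 U (mulH U (val E))
  have v2 := h2 E ((1 / 2 : ℝ) • mulH U (val U))
  have v3 := (abs_le.1 (abs_inner_mulH_le U (val U) (val E))).2
  have m1 := norm_mulH_le U (val E)
  have m2 := norm_mulH_le U (val U)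
  have m3 : ‖(1 / 2 : ℝ) • mulH U (val U)‖ = 1 / 2 * ‖mulH U (val U)‖ := by
    rw [norm_smul]; norm_num
  rw [m3] at v2
  have q1 := norm_val_le U
  have q2 := norm_val_le E
  have hy : ‖E‖ ≤ μ / 8 := by
    refine abs_le_of_sq_le_sq' ?_ (by linarith) |>.2
    linarith [sq_nonneg ‖U‖]
  have w1 : ‖U‖ * ‖mulH U (val E)‖ ≤ ‖U‖ ^ 2 * ‖E‖ := by
    calc _ ≤ ‖U‖ * (‖U‖ * ‖E‖) := by gcongr; exact m1.trans (by gcongr)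
      _ = _ := by ring
  have w2 : ‖E‖ * (1 / 2 * ‖mulH U (val U)‖) ≤ 1 / 2 * (‖U‖ ^ 2 * ‖E‖) := by
    calc _ ≤ ‖E‖ * (1 / 2 * (‖U‖ * ‖U‖)) := by gcongr; exact m2.trans (by gcongr)
      _ = _ := by ring
  have w3 : ‖U‖ * ‖val U‖ * ‖val E‖ ≤ ‖U‖ ^ 2 * ‖E‖ := by
    calc _ ≤ ‖U‖ * ‖U‖ * ‖E‖ := by gcongr
      _ = _ := by ring
  have w4 : ‖U‖ ^ 2 * ‖E‖ ≤ ‖U‖ ^ 2 * (μ / 8) := by gcongr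
  have w5 := mul_nonneg hμ.le (sq_nonneg ‖E‖)
  have w6 := mul_nonneg hμ.le (sq_nonneg ‖U‖)
  linarith

/-- Small periodic solutions vanish. -/
theorem IsSolution.eq_zero_of_periodic {a c : ℝ} (ha : a < 0) (hc : c < 0) {p μ : ℝ} (hμ : 0 < μ)
    (hp0 : 0 ≤ p) (hp2 : p ≤ 2) (h0 : 2 * μ ≤ 1) (h1 : 6 * μ ≤ 3 * -a - 1 + p)
    (h2 : 6 * μ ≤ -a * p + 3 * -a - 2 + p) (h3 : 2 * μ ≤ -a * p)
    (k1 : 6 * μ ≤ 3 * -c - 1 + (2 - p)) (k2 : 6 * μ ≤ -c * (2 - p) + 3 * -c - 2 + (2 - p))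
    (k3 : 2 * μ ≤ -c * (2 - p)) {u η : ℝ → H1} (H : IsSolution a c u η) {P : ℝ} (hP : 0 < P)
    (hu : ∀ t, u (t + P) = u t) (hη : ∀ t, η (t + P) = η t)
    (hs : ∀ t, ‖u t‖ ^ 2 + ‖η t‖ ^ 2 ≤ (μ / 8) ^ 2) (t : ℝ) : u t = 0 ∧ η t = 0 := by
  have ha' : -a ≠ 0 := by linarith
  have hc' : -c ≠ 0 := by linarith
  have hu0 : u P = u 0 := by simpa using hu 0
  have hη0 : η P = η 0 := by simpa using hη 0
  have cu := H.continuous_u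
  have cη := H.continuous_η
  let Q : ℝ → ℝ := fun s => virialForm (-a) p (u s) (mulH (u s) (val (η s)))
    + virialForm (-c) (2 - p) (η s) ((1 / 2 : ℝ) • mulH (u s) (val (u s)))
    - 1 / 2 * inner ℝ (mulH (u s) (val (u s))) (val (η s))
  have cQ : Continuous Q := by
    simp only [Q]
    unfold virialForm flux StrongEq.pot
    fun_prop
  have hint : ∫ s in (0 : ℝ)..P, Q s = 0 := by
    have i1 := H.integral_flux_id ha' hc' hu0 hη0
    have i2 := H.integral_current ha' hc' hu0 hη0
    have i3 := congrArg (fun x => (p - 1) / 2 * x) i2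
    simp only [← intervalIntegral.integral_const_mul, mul_zero] at i3
    have c1 : Continuous fun s =>
        flux (ContinuousLinearMap.id ℝ L2) (-a) (u s) (mulH (u s) (val (η s)))
        + flux (ContinuousLinearMap.id ℝ L2) (-c) (η s) ((1 / 2 : ℝ) • mulH (u s) (val (u s)))
        - 1 / 2 * inner ℝ (mulH (u s) (val (u s))) (val (η s)) := by
      unfold flux; fun_prop
    have c2 : Continuous fun s => (p - 1) / 2 *
        (inner ℝ (dv (u s)) (dv (StrongEq.pot (-a) (u s) (mulH (u s) (val (η s)))))
        - inner ℝ (dv (η s)) (dv (StrongEq.pot (-c) (η s) ((1 / 2 : ℝ) • mulH (u s) (val (u s))))))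
        := by
      unfold StrongEq.pot; fun_prop
    have := intervalIntegral.integral_add (c1.intervalIntegrable (μ := volume) 0 P)
      (c2.intervalIntegrable 0 P)
    rw [i1, i3, add_zero] at this
    refine Eq.trans (intervalIntegral.integral_congr fun s _ => ?_) this
    simp only [Q, virialForm]
    ring
  have hQ : ∀ s, μ / 2 * (‖u s‖ ^ 2 + ‖η s‖ ^ 2) ≤ Q s := fun s =>
    virial_ge (fun U F => virialForm_ge hp0 hp2 h0 h1 h2 h3 U F)
      (fun U F => virialForm_ge (by linarith) (by linarith) h0 k1 k2 k3 U F) hμ (hs s)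
  have hzero : ∀ s ∈ Ico 0 P, ‖u s‖ ^ 2 + ‖η s‖ ^ 2 = 0 := by
    intro s hs
    by_contra hne
    have hpos : 0 < ‖u s‖ ^ 2 + ‖η s‖ ^ 2 := lt_of_le_of_ne (by positivity) (Ne.symm hne)
    refine (intervalIntegral.integral_pos hP cQ.continuousOn (fun x _ => ?_)
      ⟨s, Ico_subset_Icc_self hs, ?_⟩).ne' hint
    · exact le_trans (by positivity) (hQ x)
    · exact lt_of_lt_of_le (by positivity) (hQ s)
  obtain ⟨s, hs, he⟩ := Function.Periodic.exists_mem_Ico₀ (f := fun t => (u t, η t)) (c := P)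
    (fun t => by simp [hu, hη]) hP t
  obtain ⟨e1, e2⟩ := Prod.ext_iff.1 he
  simp only at e1 e2
  have := hzero s hs
  have z1 : ‖u s‖ = 0 := by nlinarith [sq_nonneg ‖u s‖, sq_nonneg ‖η s‖]
  have z2 : ‖η s‖ = 0 := by nlinarith [sq_nonneg ‖u s‖, sq_nonneg ‖η s‖]
  rw [e1, e2]
  exact ⟨norm_eq_zero.1 z1, norm_eq_zero.1 z2⟩

/-! ### Stability of the zero solution -/

/-- Small initial data remain small. -/
theorem exists_small {a c : ℝ} (ha : a < 0) (hc : c < 0) {δ : ℝ} (hδ : 0 < δ) :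
    ∃ ε : ℝ, 0 < ε ∧ ∀ u η : ℝ → H1, IsSolution a c u η → energyNorm (u 0) (η 0) < ε →
      ∀ t, ‖u t‖ ^ 2 + ‖η t‖ ^ 2 ≤ δ ^ 2 := by
  obtain ⟨κ, hκ, hκ'⟩ := exists_between (lt_min one_pos (lt_min (neg_pos.2 ha) (neg_pos.2 hc)))
  obtain ⟨r1, r2, r3⟩ : κ < 1 ∧ κ < -a ∧ κ < -c := by simpa [lt_min_iff] using hκ'
  obtain ⟨K, hK, hKa, hKc⟩ : ∃ K : ℝ, 1 ≤ K ∧ -a ≤ K ∧ -c ≤ K :=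
    ⟨max 1 (max (-a) (-c)), le_max_left _ _, (le_max_left _ _).trans (le_max_right _ _),
      (le_max_right _ _).trans (le_max_right _ _)⟩
  -- The bound d < κ/2 lets the cubic term take at most half of the quadratic energy on the sphere
  -- of radius d.
  obtain ⟨d, hd, hd'⟩ := exists_between (lt_min hδ (half_pos hκ))
  obtain ⟨d1, d2⟩ := lt_min_iff.1 hd'
  have hpos : 0 < κ * d ^ 2 / (2 * (K + 1)) := by positivity
  have h3 : 0 < min (min 1 d) (Real.sqrt (κ * d ^ 2 / (2 * (K + 1)))) :=
    lt_min (lt_min one_pos hd) (Real.sqrt_pos.2 hpos)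
  refine ⟨_, h3, fun u η H hsm => ?_⟩
  obtain ⟨hs', s3⟩ := lt_min_iff.1 hsm
  obtain ⟨s1, s2⟩ := lt_min_iff.1 hs'
  have hy0 : energyNorm (u 0) (η 0) ^ 2 = ‖u 0‖ ^ 2 + ‖η 0‖ ^ 2 := Real.sq_sqrt (by positivity)
  have hen : 0 ≤ energyNorm (u 0) (η 0) := Real.sqrt_nonneg _
  have t3 : (K + 1) * (‖u 0‖ ^ 2 + ‖η 0‖ ^ 2) < κ * d ^ 2 / 2 := by
    rw [← hy0]
    have := (Real.lt_sqrt hen).1 s3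
    rw [lt_div_iff₀ (by positivity)] at this
    linarith
  have t2 : ‖u 0‖ ^ 2 + ‖η 0‖ ^ 2 < d ^ 2 := by
    rw [← hy0]; exact pow_lt_pow_left₀ s2 hen two_ne_zero
  have t1 : ‖η 0‖ ≤ 1 := by
    refine abs_le_of_sq_le_sq' ?_ zero_le_one |>.2
    nlinarith [sq_nonneg ‖u 0‖]
  have hcub : ∀ t, |inner ℝ (mulH (u t) (val (u t))) (val (η t))| ≤ ‖u t‖ ^ 2 * ‖η t‖ := by
    intro t
    refine (abs_inner_mulH_le _ _ _).trans ?_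
    rw [sq]
    gcongr
    · exact norm_val_le _
    · exact norm_val_le _
  have hE : ∀ t, energy (-a) (-c) (u t, η t) = 1 / 2 * (-a * ‖dv (u t)‖ ^ 2 + ‖val (u t)‖ ^ 2
      + -c * ‖dv (η t)‖ ^ 2 + ‖val (η t)‖ ^ 2
      + inner ℝ (mulH (u t) (val (u t))) (val (η t))) := by
    intro t
    simp only [energy, real_inner_self_eq_norm_sq]
  have cu := H.continuous_u
  have cη := H.continuous_η
  have cy : Continuous fun t => ‖u t‖ ^ 2 + ‖η t‖ ^ 2 := by fun_prop
  -- Barrier: at squared norm d², twice the energy is at least κd²/2, while initially it is at most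
  -- (K + 1) times the squared norm, which is smaller. By continuity the norm never reaches d.
  have hne : ∀ t, ‖u t‖ ^ 2 + ‖η t‖ ^ 2 ≠ d ^ 2 := by
    intro t ht
    have hηt : ‖η t‖ ≤ d := by
      refine abs_le_of_sq_le_sq' ?_ hd.le |>.2
      nlinarith [sq_nonneg ‖u t‖]
    have hcons := H.energy_eq (neg_pos.2 ha).ne' (neg_pos.2 hc).ne' t 0
    rw [hE, hE] at hcons
    have b1 := (abs_le.1 (hcub t)).1
    have b2 := (abs_le.1 (hcub 0)).2
    have g1 : ‖u t‖ ^ 2 * ‖η t‖ ≤ ‖u t‖ ^ 2 * (κ / 2) := by gcongr; linarith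
    have g2 : ‖u 0‖ ^ 2 * ‖η 0‖ ≤ ‖u 0‖ ^ 2 := mul_le_of_le_one_right (sq_nonneg _) t1
    have n1 := H1_norm_sq (u t)
    have n2 := H1_norm_sq (η t)
    have n3 := H1_norm_sq (u 0)
    have n4 := H1_norm_sq (η 0)
    have f1 : κ * ‖dv (u t)‖ ^ 2 ≤ -a * ‖dv (u t)‖ ^ 2 := by gcongr
    have f2 : κ * ‖dv (η t)‖ ^ 2 ≤ -c * ‖dv (η t)‖ ^ 2 := by gcongr
    have f3 : κ * ‖val (u t)‖ ^ 2 ≤ 1 * ‖val (u t)‖ ^ 2 := by gcongr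
    have f4 : κ * ‖val (η t)‖ ^ 2 ≤ 1 * ‖val (η t)‖ ^ 2 := by gcongr
    have f5 : -a * ‖dv (u 0)‖ ^ 2 ≤ K * ‖dv (u 0)‖ ^ 2 := by gcongr
    have f6 : -c * ‖dv (η 0)‖ ^ 2 ≤ K * ‖dv (η 0)‖ ^ 2 := by gcongr
    have f7 : 1 * ‖val (u 0)‖ ^ 2 ≤ K * ‖val (u 0)‖ ^ 2 := by gcongr
    have f8 : 1 * ‖val (η 0)‖ ^ 2 ≤ K * ‖val (η 0)‖ ^ 2 := by gcongr
    have low : κ * (‖u t‖ ^ 2 + ‖η t‖ ^ 2) - ‖u t‖ ^ 2 * (κ / 2)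
        ≤ K * (‖u 0‖ ^ 2 + ‖η 0‖ ^ 2) + ‖u 0‖ ^ 2 := by
      have j1 : κ * ‖u t‖ ^ 2 = κ * ‖val (u t)‖ ^ 2 + κ * ‖dv (u t)‖ ^ 2 := by rw [n1]; ring
      have j2 : κ * ‖η t‖ ^ 2 = κ * ‖val (η t)‖ ^ 2 + κ * ‖dv (η t)‖ ^ 2 := by rw [n2]; ring
      have j3 : K * ‖u 0‖ ^ 2 = K * ‖val (u 0)‖ ^ 2 + K * ‖dv (u 0)‖ ^ 2 := by rw [n3]; ring
      have j4 : K * ‖η 0‖ ^ 2 = K * ‖val (η 0)‖ ^ 2 + K * ‖dv (η 0)‖ ^ 2 := by rw [n4]; ring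
      linarith
    have : ‖u t‖ ^ 2 * (κ / 2) ≤ d ^ 2 * (κ / 2) :=
      mul_le_mul_of_nonneg_right (by linarith [sq_nonneg ‖η t‖]) (by positivity)
    rw [ht] at low
    linarith [sq_nonneg ‖η 0‖]
  intro t
  by_contra! hlt
  have hdδ : d ^ 2 ≤ δ ^ 2 := by gcongr
  obtain ⟨s, -, hs⟩ := intermediate_value_uIcc (a := 0) (b := t) cy.continuousOn
    (show d ^ 2 ∈ uIcc _ _ from ⟨inf_le_left.trans t2.le, le_sup_of_le_right (by linarith)⟩)
  exact hne s hs

/-! ### Translations -/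

theorem H1_ext {f g : H1} (h : f.fn =ᵐ[volume] g.fn) : f = g := val_injective (Lp.ext h)

theorem IsWeakDeriv.translate {f g : ℝ → ℝ} (h : IsWeakDeriv f g) (r : ℝ) :
    IsWeakDeriv (fun x => f (x - r)) (fun x => g (x - r)) := by
  intro ψ hψ
  have hk : IsTest (fun x => ψ (x + r)) := ⟨hψ.1.comp (contDiff_id.add contDiff_const),
    hψ.2.comp_homeomorph (Homeomorph.addRight r)⟩
  have e1 := integral_sub_right_eq_self (μ := volume) (fun x => f x * deriv ψ (x + r)) r
  have e2 := integral_sub_right_eq_self (μ := volume) (fun x => g x * ψ (x + r)) r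
  simp only [sub_add_cancel] at e1 e2
  rw [e1, e2, ← h _ hk]
  refine integral_congr_ae (Eventually.of_forall fun x => ?_)
  simp only [deriv_comp_add_const]

theorem IsWeakDeriv.congr {f g f' g' : ℝ → ℝ} (h : IsWeakDeriv f g) (hf : f =ᵐ[volume] f')
    (hg : g =ᵐ[volume] g') : IsWeakDeriv f' g' := by
  intro ψ hψ
  have e1 : ∫ x, f' x * deriv ψ x = ∫ x, f x * deriv ψ x :=
    integral_congr_ae (by filter_upwards [hf] with x hx; rw [hx])
  have e2 : ∫ x, g' x * ψ x = ∫ x, g x * ψ x :=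
    integral_congr_ae (by filter_upwards [hg] with x hx; rw [hx])
  rw [e1, e2, h ψ hψ]

/-- Translates of `H¹` functions have the translated derivatives. -/
theorem dx_ae_eq_translate {f g : H1} {r : ℝ} (h : f.fn =ᵐ[volume] fun x => g.fn (x - r)) :
    f.dx =ᵐ[volume] fun x => g.dx (x - r) := by
  have hm := measurePreserving_sub_right (volume : Measure ℝ) r
  have c1 := Lp.coeFn_compMeasurePreserving (val g) hm
  have c2 := Lp.coeFn_compMeasurePreserving (dv g) hm
  let k : H1 := ⟨WithLp.toLp 2 (Lp.compMeasurePreserving _ hm (val g),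
    Lp.compMeasurePreserving _ hm (dv g)), by
      exact (IsWeakDeriv.translate (f := val g) (g := dv g) g.2 r).congr c1.symm c2.symm⟩
  have : f = k := H1_ext (h.trans c1.symm)
  rw [this]
  exact c2

theorem tendsto_setIntegral_tail {g : ℝ → ℝ} (hg : Integrable g) :
    Tendsto (fun n : ℕ => ∫ x, {x : ℝ | (n : ℝ) ≤ |x|}.indicator g x) atTop (𝓝 0) := by
  have hms : ∀ n : ℕ, MeasurableSet {x : ℝ | (n : ℝ) ≤ |x|} := fun n =>
    measurableSet_le measurable_const measurable_norm
  have := tendsto_integral_of_dominated_convergence (μ := volume)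
    (F := fun n : ℕ => {x : ℝ | (n : ℝ) ≤ |x|}.indicator g) (f := fun _ => 0) (fun x => ‖g x‖)
    (fun n => hg.aestronglyMeasurable.indicator (hms n)) hg.norm
    (fun n => Eventually.of_forall fun x => norm_indicator_le_norm_self _ _)
    (Eventually.of_forall fun x => by
      refine tendsto_const_nhds.congr' ?_
      filter_upwards [tendsto_natCast_atTop_atTop.eventually_gt_atTop |x|] with n hn
      rw [indicator_of_notMem]
      simpa using hn)
  simpa using this

/-- Linear motion leaves the region `I` ballistically. -/
theorem exists_forall_add_le {ω C₀ : ℝ} (hω : ω ≠ 0) (R : ℝ) :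
    ∃ T : ℝ, 2 ≤ T ∧ ∀ t : ℝ, T ≤ |t| → C₀ * |t| / Real.log |t| ^ 2 + R ≤ |ω * t| := by
  have hω' : 0 < |ω| := abs_pos.2 hω
  have hlim : Tendsto (fun x : ℝ => C₀ / Real.log x ^ 2) atTop (𝓝 0) :=
    tendsto_const_nhds.div_atTop
      ((tendsto_pow_atTop two_ne_zero).comp Real.tendsto_log_atTop)
  have hev := (hlim.eventually_lt_const (half_pos hω')).and (eventually_ge_atTop (2 * R / |ω|))
  obtain ⟨T, hT⟩ := eventually_atTop.1 hev
  refine ⟨max 2 T, le_max_left _ _, fun t ht => ?_⟩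
  obtain ⟨h1, h2⟩ := hT |t| ((le_max_right _ _).trans ht)
  rw [div_le_iff₀ hω'] at h2
  have h3 : C₀ * |t| / Real.log |t| ^ 2 ≤ |ω| / 2 * |t| := by
    rw [mul_div_right_comm]
    exact mul_le_mul_of_nonneg_right h1.le (abs_nonneg t)
  rw [abs_mul]
  linarith

theorem abs_lt_of_mem_I {C₀ t x : ℝ} (h : x ∈ I C₀ t) : |x| < C₀ * |t| / Real.log |t| ^ 2 :=
  abs_lt.2 h

theorem disjoint_Icc_I {C₀ t y R : ℝ} (h : C₀ * |t| / Real.log |t| ^ 2 + R ≤ |y|) :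
    Disjoint (Icc (y - R) (y + R)) (I C₀ t) := by
  rw [Set.disjoint_left]
  intro x hx hI
  have h1 := abs_lt_of_mem_I hI
  have h2 : |y - x| ≤ R := abs_le.2 ⟨by linarith [hx.2], by linarith [hx.1]⟩
  have h3 := abs_add_le (y - x) x
  rw [sub_add_cancel] at h3
  linarith

theorem integrable_energy_density (f g : H1) :
    Integrable fun x => f.fn x ^ 2 + f.dx x ^ 2 + g.fn x ^ 2 + g.dx x ^ 2 :=
  (((Lp.memLp (val f)).integrable_sq.add (Lp.memLp (dv f)).integrable_sq).add
    (Lp.memLp (val g)).integrable_sq).add (Lp.memLp (dv g)).integrable_sq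

theorem IsSolitaryWave.exists_localEnergyNorm_lt {a c ω : ℝ} {U N : H1} {u η : ℝ → H1}
    (H : IsSolitaryWave a c ω U N u η) (hω : ω ≠ 0) (C₀ : ℝ) {δ : ℝ} (hδ : 0 < δ) :
    ∃ T : ℝ, 2 ≤ T ∧ ∀ t : ℝ, T ≤ |t| → localEnergyNorm (I C₀ t) (u t) (η t) < δ := by
  let g : ℝ → ℝ := fun x => U.fn x ^ 2 + U.dx x ^ 2 + N.fn x ^ 2 + N.dx x ^ 2
  have hg : Integrable g := integrable_energy_density U N
  have hg0 : ∀ x, 0 ≤ g x := fun x => by simp only [g]; positivity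
  obtain ⟨n, hn⟩ := ((tendsto_setIntegral_tail hg).eventually_lt_const
    (by positivity : (0 : ℝ) < δ ^ 2)).exists
  obtain ⟨T, hT2, hT⟩ := exists_forall_add_le (C₀ := C₀) hω n
  refine ⟨T, hT2, fun t ht => ?_⟩
  rw [localEnergyNorm, Real.sqrt_lt' hδ]
  refine lt_of_le_of_lt ?_ hn
  have hms : MeasurableSet {x : ℝ | (n : ℝ) ≤ |x|} :=
    measurableSet_le measurable_const measurable_norm
  have hI : MeasurableSet (I C₀ t) := measurableSet_Ioo
  -- Move the tail integral of the profile to the centre ω t; at large |t| every point of I(t) lies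
  -- in this translated tail.
  rw [← integral_sub_right_eq_self (({x : ℝ | (n : ℝ) ≤ |x|}).indicator g) (ω * t),
    ← integral_indicator hI]
  refine integral_mono_ae ((integrable_energy_density (u t) (η t)).indicator hI)
    ((hg.indicator hms).comp_sub_right (ω * t)) ?_
  filter_upwards [H.u_eq t, H.η_eq t, dx_ae_eq_translate (H.u_eq t), dx_ae_eq_translate (H.η_eq t)]
    with x h1 h2 h3 h4
  by_cases hx : x ∈ I C₀ t
  · have hx' : x - ω * t ∈ {x : ℝ | (n : ℝ) ≤ |x|} := by
      have h5 := abs_lt_of_mem_I hx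
      have h6 := hT t ht
      have h7 := abs_sub_abs_le_abs_sub (ω * t) x
      rw [abs_sub_comm] at h7
      change (n : ℝ) ≤ _
      linarith
    rw [indicator_of_mem hx, indicator_of_mem hx', h1, h2, h3, h4]
  · rw [indicator_of_notMem hx]
    exact indicator_nonneg (fun x _ => hg0 x) _

end ABCD

end

/-! ### Proof of the three statements -/

theorem corollary1p2 (a b c : ℝ) (habc : ABCD.IsDispersionLike a b c) :
    ∃ ε : ℝ, 0 < ε ∧
      -- no small nontrivial solitary wave of zero speed
      (¬ ∃ (U N : ABCD.H1) (u η : ℝ → ABCD.H1), (U ≠ 0 ∨ N ≠ 0) ∧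
        ABCD.energyNorm U N < ε ∧ ABCD.IsSolitaryWave a c 0 U N u η) ∧
      -- every small solitary wave of nonzero speed exits `I(t)` in finite time
      (∀ (ω : ℝ) (U N : ABCD.H1) (u η : ℝ → ABCD.H1), ω ≠ 0 →
        ABCD.energyNorm U N < ε → ABCD.IsSolitaryWave a c ω U N u η →
        ∀ C₀ : ℝ, 0 < C₀ →
          (∀ R : ℝ, ∃ T : ℝ, 2 ≤ T ∧ ∀ t : ℝ, T ≤ |t| →
            Disjoint (Set.Icc (ω * t - R) (ω * t + R)) (ABCD.I C₀ t)) ∧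
          (∀ δ : ℝ, 0 < δ → ∃ T : ℝ, 2 ≤ T ∧ ∀ t : ℝ, T ≤ |t| →
            ABCD.localEnergyNorm (ABCD.I C₀ t) (u t) (η t) < δ)) ∧
      -- no small nontrivial standing breather
      (¬ ∃ u η : ℝ → ABCD.H1, (∃ t : ℝ, u t ≠ 0 ∨ η t ≠ 0) ∧
        ABCD.energyNorm (u 0) (η 0) < ε ∧ ABCD.IsBreather a c u η) := by
  obtain ⟨⟨-, ha, hc, -⟩, hdisp⟩ := habc
  obtain ⟨p, μ, hμ, hp0, hp2, h0, h1, h2, h3, k1, k2, k3⟩ :=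
    ABCD.exists_coercive (neg_pos.2 ha) (neg_pos.2 hc) (by linarith)
  obtain ⟨ε, hε, hsmall⟩ := ABCD.exists_small ha hc (by positivity : 0 < μ / 8)
  have key : ∀ u η : ℝ → ABCD.H1, ABCD.energyNorm (u 0) (η 0) < ε → ABCD.IsBreather a c u η →
      ∀ t, u t = 0 ∧ η t = 0 := by
    rintro u η hs ⟨H, P, hP, hper⟩ t
    exact H.eq_zero_of_periodic ha hc hμ hp0 hp2 h0 h1 h2 h3 k1 k2 k3 hP (fun t => (hper t).1)
      (fun t => (hper t).2) (hsmall u η H hs) t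
  refine ⟨ε, hε, ?_, ?_, ?_⟩
  · rintro ⟨U, N, u, η, hne, hs, H⟩
    have hu : ∀ t, u t = U := fun t => ABCD.H1_ext (by simpa using H.u_eq t)
    have hη : ∀ t, η t = N := fun t => ABCD.H1_ext (by simpa using H.η_eq t)
    -- A stationary solution has every period; 1 is chosen.
    obtain ⟨z1, z2⟩ := key u η (by rwa [hu, hη])
      ⟨H.solution, 1, one_pos, fun t => by simp [hu, hη]⟩ 0
    rw [hu] at z1
    rw [hη] at z2
    exact hne.elim (fun h => h z1) (fun h => h z2)
  · intro ω U N u η hω _ H C₀ _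
    refine ⟨fun R => ?_, fun δ hδ => H.exists_localEnergyNorm_lt hω C₀ hδ⟩
    obtain ⟨T, hT2, hT⟩ := ABCD.exists_forall_add_le (C₀ := C₀) hω R
    exact ⟨T, hT2, fun t ht => ABCD.disjoint_Icc_I (hT t ht)⟩
  · rintro ⟨u, η, ⟨t, ht⟩, hs, H⟩
    obtain ⟨z1, z2⟩ := key u η hs H t
    exact ht.elim (fun h => h z1) (fun h => h z2)
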